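/- Let $S\subset\mathbb R^3$ be a compact topological 2-manifold without boundary. A *viewpoint at infinity* is a unit vector $d$ (pointing from the scene towards the viewpoint); averages and expectations are taken with respect to the uniform probability measure on the unit sphere, and the *rays* from $d$ are the lines with direction $d$. A *side* of $S$ is the closure of a connected component of $\mathbb R^3\setminus S$ (if $S$ is connected there are two of them). The (transparent) *silhouette* of $S$ from $d$ is the set of points $p\in S$ such that, $R$ being the ray through $p$, the point $p$ is the closest point to the viewpoint on its connected component of $R\cap S$, and some open segment of $R$ contains this component and is contained in one side of $S$. Its *length* is the length (one-dimensional Hausdorff measure), counted with multiplicity, of its orthogonal projection along $d$ onto a plane orthogonal to $d$. Let $\mathrm{silh}(S)$ be the average of this length over all viewpoints at infinity, and assume $\mathrm{silh}(S)<\infty$. Let $\alpha,\beta>0$, and let $P_n$ be a closed polyhedral surface embedded in $\mathbb R^3$ with $n$ triangular faces (a finite simplicial complex made of triangles with their edges and vertices, each edge being shared by exactly two triangles), together with a homeomorphism $f_n:P_n\to S$, such that 1. every edge of $P_n$ has length at least $\alpha/\sqrt n$; 2. for every point $x\in P_n$, $\|x-f_n(x)\|<\beta\,h(x)/\sqrt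 n$, where $h(x)$ is the smallest height of the triangle(s) of $P_n$ containing $x$. The silhouette of $P_n$ from $d$ is the set of edges adjacent to a front face and a back face, where the normals of the two faces are oriented consistently across the edge and a face with normal $\nu$ is a front face if $\langle \nu,d\rangle>0$ and a back face if $\langle\nu,d\rangle<0$. (For the null set of directions in which a face adjacent to the edge is seen edge-on, the edge is counted if a point of its relative interior lies on the silhouette of the surface $P_n$ as defined above.) Then the expected number of edges of the silhouette of $P_n$, for a uniformly random viewpoint at infinity, is $O(\sqrt n)$, with a constant that depends only on $S,\alpha,\beta$. More precisely, for every $n$ and every such $P_n$ and $f_n$, it is at most $$\left(15\,\beta+\frac{24}{\alpha}\,\mathrm{silh}(S)\right)\sqrt n .$$ -/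

import Mathlib

open MeasureTheory Set
open scoped ENNReal RealInnerProductSpace Matrix

noncomputable section

/-- Euclidean three-space. -/
abbrev E3 : Type := EuclideanSpace ℝ (Fin 3)

/-- Viewpoints at infinity, as unit vectors: `d` points from the scene towards the viewpoint. -/
abbrev Viewpoint : Type := Metric.sphere (0 : E3) 1

/-- The uniform probability measure on the viewpoints at infinity (normalized surface measure). -/
def uniformViewpoint : Measure Viewpoint :=
  ((volume : Measure E3).toSphere univ)⁻¹ • (volume : Measure E3).toSphere

/-! ### Surfaces and their silhouettes -/

/-- `S ⊆ ℝ³` is a compact topological 2-manifold without boundary. -/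
def IsClosedSurface (S : Set E3) : Prop :=
  IsCompact S ∧ Nonempty (ChartedSpace (EuclideanSpace ℝ (Fin 2)) S)

/-- The sides of `S`: the closures of the connected components of its complement.  A compact
connected surface without boundary has exactly two of them. -/
def IsSide (S O : Set E3) : Prop :=
  ∃ x ∈ Sᶜ, O = closure (connectedComponentIn Sᶜ x)

/-- The ray through `p` from the viewpoint at infinity in direction `d` (a full line). -/
def viewRay (d p : E3) : Set E3 := {q | ∃ s : ℝ, q = p + s • d}

/-- The (transparent) silhouette of `S` from the viewpoint at infinity in direction `d`, as a set
of points of `S`: the points `p` that are the closest to the viewpoint on their connected component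
of `R ∩ S`, where `R` is the ray through `p`, such that this component satisfies the non-crossing
property: some open segment of `R` contains it and is contained in a side of `S`. -/
def silhouette (S : Set E3) (d : E3) : Set E3 :=
  {p | p ∈ S ∧
    (∀ q ∈ connectedComponentIn (viewRay d p ∩ S) p, ⟪q, d⟫ ≤ ⟪p, d⟫) ∧
    ∃ a ∈ viewRay d p, ∃ b ∈ viewRay d p, a ≠ b ∧
      connectedComponentIn (viewRay d p ∩ S) p ⊆ openSegment ℝ a b ∧
      ∃ O, IsSide S O ∧ openSegment ℝ a b ⊆ O}

/-- Orthogonal projection along the unit vector `d` onto the plane through `0` orthogonal to `d`. -/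
def projAlong (d p : E3) : E3 := p - ⟪p, d⟫ • d

/-- The projected length of the silhouette of `S` from direction `d`, counted with multiplicity:
the integral with respect to one-dimensional Hausdorff measure of the number of silhouette points
that project onto a given point. -/
def silhouetteLength (S : Set E3) (d : Viewpoint) : ℝ≥0∞ :=
  ∫⁻ y : E3, (({p | p ∈ silhouette S d ∧ projAlong d p = y}.encard : ℕ∞) : ℝ≥0∞) ∂μH[1]

/-- `silh(S)`: the average over all viewpoints at infinity of the length of the silhouette. -/
def silh (S : Set E3) : ℝ≥0∞ :=
  ∫⁻ d : Viewpoint, silhouetteLength S d ∂uniformViewpoint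

/-! ### Polyhedra and their silhouettes -/

/-- The triangles of a simplicial complex, given by their sets of vertices. -/
def triangles (K : Geometry.SimplicialComplex ℝ E3) : Set (Finset E3) :=
  {t | t ∈ K.faces ∧ t.card = 3}

/-- The edges of a simplicial complex, given by their sets of end points. -/
def edges (K : Geometry.SimplicialComplex ℝ E3) : Set (Finset E3) :=
  {e | e ∈ K.faces ∧ e.card = 2}

/-- `K` is a closed polyhedral surface with triangular faces (embedded in `ℝ³`): a finite complex
that consists of triangles with their edges and vertices, each edge being shared by exactly two
triangles. -/
def IsPolyhedron (K : Geometry.SimplicialComplex ℝ E3) : Prop :=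
  K.faces.Finite ∧ (∀ s ∈ K.faces, ∃ t ∈ triangles K, s ⊆ t) ∧
    ∀ e ∈ edges K, {t | t ∈ triangles K ∧ e ⊆ t}.ncard = 2

/-- A normal vector of the oriented triangle `a b c`. -/
def faceNormal (a b c : E3) : E3 :=
  WithLp.toLp 2 (WithLp.ofLp (b - a) ⨯₃ WithLp.ofLp (c - a))

/-- `e` is an edge adjacent to a front face and a back face from direction `d`.  The two faces
`a b c` and `b a c'` are oriented consistently across their common edge. -/
def SeparatesFrontBack (K : Geometry.SimplicialComplex ℝ E3) (d : E3) (e : Finset E3) : Prop :=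
  ∃ a b c c' : E3, ∃ t ∈ triangles K, ∃ t' ∈ triangles K, t ≠ t' ∧
    (e : Set E3) = {a, b} ∧ (t : Set E3) = {a, b, c} ∧ (t' : Set E3) = {b, a, c'} ∧
    0 < ⟪faceNormal a b c, d⟫ ∧ ⟪faceNormal b a c', d⟫ < 0

/-- The triangle `t` is seen edge-on from direction `d`. -/
def SeenEdgeOn (d : E3) (t : Finset E3) : Prop :=
  d ∈ (affineSpan ℝ (t : Set E3)).direction

/-- The edges on the silhouette of `K` from direction `d`.  If a face adjacent to the edge is seen
edge-on, the silhouette is that of the surface `K.space`, and the edge is counted when some point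
of its relative interior lies on it. -/
def silhouetteEdges (K : Geometry.SimplicialComplex ℝ E3) (d : E3) : Set (Finset E3) :=
  {e | e ∈ edges K ∧
    (SeparatesFrontBack K d e ∨
      ((∃ t ∈ triangles K, e ⊆ t ∧ SeenEdgeOn d t) ∧
        ∃ a b : E3, (e : Set E3) = {a, b} ∧ (openSegment ℝ a b ∩ silhouette K.space d).Nonempty))}

/-- The expected number of silhouette edges for a uniformly random viewpoint at infinity. -/
def expectedSilhouetteSize (K : Geometry.SimplicialComplex ℝ E3) : ℝ≥0∞ :=
  ∫⁻ d : Viewpoint, (((silhouetteEdges K d).encard : ℕ∞) : ℝ≥0∞) ∂uniformViewpoint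

/-! ### Approximation of a surface by a polyhedron -/

/-- `h(x)`: the smallest height (distance from a vertex `v` to the line through the other two) of
the triangles of `K` that contain `x`.  For `x ∈ K.space` and `K` a polyhedron, the infimum is over
a finite nonempty set. -/
def smallestHeight (K : Geometry.SimplicialComplex ℝ E3) (x : E3) : ℝ :=
  sInf {r | ∃ t ∈ triangles K, x ∈ convexHull ℝ (t : Set E3) ∧
    ∃ v ∈ t, r = Metric.infDist v (affineSpan ℝ ((t : Set E3) \ {v}) : Set E3)}

/-- `K` is a polyhedron with `n` triangular faces that approximates `S` through the homeomorphism
`f`, with parameters `α` and `β`. -/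
structure Approximates (S : Set E3) (α β : ℝ) (n : ℕ) (K : Geometry.SimplicialComplex ℝ E3)
    (f : K.space ≃ₜ S) : Prop where
  polyhedron : IsPolyhedron K
  card_triangles : (triangles K).ncard = n
  edge_length : ∀ e ∈ edges K, ∀ a ∈ e, ∀ b ∈ e, a ≠ b → α / √(n : ℝ) ≤ dist a b
  dist_lt : ∀ x : K.space, dist (x : E3) (f x : E3) < β * smallestHeight K x / √(n : ℝ)

end

noncomputable section

/-! Almost surely no face is seen edge-on, and an edge `e = ab` is then on the silhouette only if
`d` lies in the double wedge cut out by the planes of its two faces. So the expectation is at most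
the sum over the edges of the probabilities of these wedges. A wedge constrains only the component
of `d` orthogonal to `e`; hence the squared sine of the angle between `d` and `e` has mean `2/3` on
it, and its probability is `3/2` times the integral of this squared sine
(`uniformViewpoint_doubleWedge`).

Put `δ = β / √n` and split the wedge. The directions whose angle with one of the two face planes has
sine less than `5δ` lie in zones around great circles; Archimedes' theorem and a symmetry bound
their contribution by `10δ` per edge (`uniformViewpoint_doubleWedge_le`). There are at most `3n/2`
edges, whence the term `15β√n`.

From the remaining directions the two triangles project to the same side of the projection of `e`,
and neither is too thin. The homeomorphism moves points by less than `δ` times the local smallest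
height. Hence, over the middle fifth of the projected edge, the extreme points of the image of the
hinge, on the side away from the triangles, avoid the image of its rim. The ray through such a point
has free space beside it, so it carries a point of the silhouette of `S` (`exists_mem_silhouette`).
This gives a silhouette arc of projected length at least one fifth of that of `e`
(`IsHinge.exists_silhouette_arc`).

A silhouette point serves at most three edges, those of one triangle containing its preimage. So,
from each `d`, the projected lengths of these edges sum to at most `15` times the silhouette length
of `S`. Dividing by edge lengths at least `α / √n` turns projected lengths into sines, which
dominate squared sines; averaging and multiplying by `3/2` gives `(45/2) silh(S) √n / α`, and `45/2
≤ 24`. -/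

/-! ### Polar coordinates and homogeneous functions on the sphere. -/

theorem lintegral_eq_lintegral_sphere (F : E3 → ℝ≥0∞) (hF : Measurable F) :
    ∫⁻ x, F x = ∫⁻ d : Viewpoint, (∫⁻ r in Ioi (0 : ℝ), ENNReal.ofReal (r ^ 2) * F (r • (d : E3)))
      ∂(volume : Measure E3).toSphere := by
  have hmp := (volume : Measure E3).measurePreserving_homeomorphUnitSphereProd
  have hfin : Module.finrank ℝ E3 = 3 := by simp
  have hG : Measurable fun p : Viewpoint × Ioi (0 : ℝ) ↦ F ((p.2 : ℝ) • (p.1 : E3)) := by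
    apply hF.comp
    fun_prop
  calc ∫⁻ x, F x = ∫⁻ x in ({0}ᶜ : Set E3), F x := by rw [restrict_compl_singleton]
    _ = ∫⁻ x : ({0}ᶜ : Set E3), F x ∂((volume : Measure E3).comap Subtype.val) :=
        (lintegral_subtype_comap (measurableSet_singleton _).compl F).symm
    _ = ∫⁻ x : ({0}ᶜ : Set E3), (fun p : Viewpoint × Ioi (0 : ℝ) ↦ F ((p.2 : ℝ) • (p.1 : E3)))
          (homeomorphUnitSphereProd E3 x) ∂((volume : Measure E3).comap Subtype.val) := by
        apply lintegral_congr
        intro x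
        have hx : ‖(x : E3)‖ ≠ 0 := norm_ne_zero_iff.2 x.2
        simp [smul_smul, hx]
    _ = ∫⁻ p, F ((p.2 : ℝ) • (p.1 : E3))
          ∂((volume : Measure E3).toSphere.prod (Measure.volumeIoiPow (Module.finrank ℝ E3 - 1))) :=
        hmp.lintegral_comp hG
    _ = _ := by
        rw [lintegral_prod _ hG.aemeasurable, hfin]
        apply lintegral_congr
        intro d
        have hGd : Measurable fun r : ℝ ↦ F (r • (d : E3)) := hF.comp (by fun_prop)
        rw [Measure.volumeIoiPow, lintegral_withDensity_eq_lintegral_mul _ (by fun_prop)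
          (show Measurable fun y : Ioi (0 : ℝ) ↦ F ((y : ℝ) • (d : E3)) from
            hGd.comp measurable_subtype_coe)]
        rw [← lintegral_subtype_comap measurableSet_Ioi]
        rfl

/-- A nonnegative function that is positively homogeneous of degree `k`. -/
def PosHomogeneous (k : ℕ) (Φ : E3 → ℝ≥0∞) : Prop :=
  ∀ (r : ℝ) (x : E3), 0 < r → Φ (r • x) = ENNReal.ofReal (r ^ k) * Φ x

/-- Polar coordinates separate the variables. The radial weight `γ` is free: the indicator of the
ball gives rotation invariance and Archimedes' theorem, a Gaussian gives second moments. -/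
theorem PosHomogeneous.lintegral_mul_norm {k : ℕ} {Φ : E3 → ℝ≥0∞} (hΦ : PosHomogeneous k Φ)
    (hm : Measurable Φ) {γ : ℝ → ℝ≥0∞} (hγ : Measurable γ) :
    ∫⁻ x, Φ x * γ ‖x‖ = (∫⁻ d : Viewpoint, Φ d ∂(volume : Measure E3).toSphere) *
      ∫⁻ r in Ioi (0 : ℝ), ENNReal.ofReal (r ^ (k + 2)) * γ r := by
  rw [lintegral_eq_lintegral_sphere _ (by fun_prop), ← lintegral_mul_const _ (by fun_prop)]
  apply lintegral_congr
  intro d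
  rw [← lintegral_const_mul _ (by fun_prop)]
  apply setLIntegral_congr_fun measurableSet_Ioi
  intro r (hr : 0 < r)
  have hd : ‖(d : E3)‖ = 1 := by simp
  simp only
  rw [hΦ r d hr, norm_smul, hd, mul_one, Real.norm_of_nonneg hr.le, pow_add,
    ENNReal.ofReal_mul (by positivity)]
  ring

theorem lintegral_Ioi_pow_mul_indicator (m : ℕ) :
    ∫⁻ r in Ioi (0 : ℝ), ENNReal.ofReal (r ^ m) * (Iio (1 : ℝ)).indicator 1 r
      = ENNReal.ofReal (1 / (m + 1)) := by
  have h1 : ∀ r : ℝ, ENNReal.ofReal (r ^ m) * (Iio (1 : ℝ)).indicator 1 r =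
      (Iio (1 : ℝ)).indicator (fun r ↦ ENNReal.ofReal (r ^ m)) r := by
    intro r
    by_cases h : r ∈ Iio (1 : ℝ) <;> simp [h]
  simp_rw [h1]
  rw [setLIntegral_indicator measurableSet_Iio, inter_comm, Ioi_inter_Iio,
    Measure.restrict_congr_set Ioo_ae_eq_Ioc, ← ofReal_integral_eq_lintegral_ofReal
    (intervalIntegral.intervalIntegrable_pow _).1, ← intervalIntegral.integral_of_le zero_le_one]
  · simp
  · filter_upwards [ae_restrict_mem measurableSet_Ioc] with y hy
    exact pow_nonneg hy.1.le _

/-- Invariance of Lebesgue measure under isometries passes to the sphere by weighting with the unit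
ball and cancelling the radial factor `1 / (k + 3)`. -/
theorem PosHomogeneous.lintegral_sphere_repr {k : ℕ} {Φ : E3 → ℝ≥0∞} (hΦ : PosHomogeneous k Φ)
    (hm : Measurable Φ) (b : OrthonormalBasis (Fin 3) ℝ E3) :
    ∫⁻ d : Viewpoint, Φ (b.repr d) ∂(volume : Measure E3).toSphere =
      ∫⁻ d : Viewpoint, Φ d ∂(volume : Measure E3).toSphere := by
  have hγ : Measurable ((Iio (1 : ℝ)).indicator (1 : ℝ → ℝ≥0∞)) :=
    measurable_one.indicator measurableSet_Iio
  have hb : Measurable b.repr := b.repr.continuous.measurable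
  have hΦ' : PosHomogeneous k (fun x ↦ Φ (b.repr x)) := by
    intro r x hr
    simp only [map_smul]
    exact hΦ r _ hr
  have h1 := hΦ.lintegral_mul_norm hm hγ
  have h2 := hΦ'.lintegral_mul_norm (hm.comp hb) hγ
  have h3 : ∫⁻ x, Φ (b.repr x) * (Iio (1 : ℝ)).indicator (1 : ℝ → ℝ≥0∞) ‖x‖ =
      ∫⁻ x, Φ x * (Iio (1 : ℝ)).indicator (1 : ℝ → ℝ≥0∞) ‖x‖ := by
    have := b.measurePreserving_repr.lintegral_comp
      (f := fun x ↦ Φ x * (Iio (1 : ℝ)).indicator (1 : ℝ → ℝ≥0∞) ‖x‖) (by fun_prop)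
    simpa using this
  rw [h3, h1, lintegral_Ioi_pow_mul_indicator] at h2
  refine ((ENNReal.mul_left_inj ?_ ENNReal.ofReal_ne_top).1 h2).symm
  have : (0 : ℝ) < 1 / ((k + 2 : ℕ) + 1) := by positivity
  simpa using this

/-! ### Gaussian moments and zones of the sphere. -/

theorem measurePreserving_coord_prod :
    MeasurePreserving (fun x : E3 ↦ ((x 0, fun i : Fin 2 ↦ x i.succ) : ℝ × (Fin 2 → ℝ)))
      volume volume := by
  have h1 := PiLp.volume_preserving_ofLp (Fin 3)
  have h2 := volume_preserving_piFinSuccAbove (fun _ : Fin 3 => ℝ) 0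
  exact h2.comp h1

theorem lintegral_exp_neg_sq_pos :
    ∫⁻ x : ℝ, ENNReal.ofReal (Real.exp (-x ^ 2)) = ENNReal.ofReal (√Real.pi) := by
  have h := integral_gaussian 1
  have hi := integrable_exp_neg_mul_sq (b := 1) one_pos
  rw [← ofReal_integral_eq_lintegral_ofReal (by simpa using hi)
    (Filter.Eventually.of_forall fun x ↦ (Real.exp_pos _).le)]
  congr 1
  simpa using h

theorem lintegral_Ioi_pow_mul_exp_neg_sq (m : ℕ) :
    ∫⁻ r in Ioi (0 : ℝ), ENNReal.ofReal (r ^ m) * ENNReal.ofReal (Real.exp (-r ^ 2)) =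
      ENNReal.ofReal (1 / 2 * Real.Gamma ((m + 1) / 2)) := by
  have h := integral_rpow_mul_exp_neg_mul_rpow (p := 2) (q := m) (b := 1) (by norm_num)
    (by have : (0 : ℝ) ≤ m := by positivity
        linarith) one_pos
  have hi := integrableOn_rpow_mul_exp_neg_mul_sq (b := 1) one_pos (s := m)
    (by have : (0 : ℝ) ≤ m := by positivity
        linarith)
  simp only [Real.rpow_natCast, neg_mul, one_mul, Real.one_rpow, Real.rpow_two] at h hi
  rw [← h, ofReal_integral_eq_lintegral_ofReal hi]
  · apply setLIntegral_congr_fun measurableSet_Ioi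
    intro r (hr : 0 < r)
    exact (ENNReal.ofReal_mul (by positivity)).symm
  · filter_upwards [ae_restrict_mem measurableSet_Ioi] with r hr
    have : (0 : ℝ) < r := hr
    positivity

theorem lintegral_sq_mul_exp_neg_sq :
    ∫⁻ x : ℝ, ENNReal.ofReal (x ^ 2) * ENNReal.ofReal (Real.exp (-x ^ 2)) =
      ENNReal.ofReal (√Real.pi / 2) := by
  have h1 := lintegral_Ioi_pow_mul_exp_neg_sq 2
  have h2 : ∫⁻ x in Iio (0 : ℝ), ENNReal.ofReal (x ^ 2) * ENNReal.ofReal (Real.exp (-x ^ 2)) =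
      ∫⁻ x in Ioi (0 : ℝ), ENNReal.ofReal (x ^ 2) * ENNReal.ofReal (Real.exp (-x ^ 2)) := by
    have := (Measure.measurePreserving_neg (volume : Measure ℝ)).setLIntegral_comp_preimage
      (s := Ioi (0 : ℝ)) measurableSet_Ioi
      (f := fun x ↦ ENNReal.ofReal (x ^ 2) * ENNReal.ofReal (Real.exp (-x ^ 2))) (by fun_prop)
    rw [← this]
    simp
  have hG : Real.Gamma (((2 : ℕ) + 1) / 2) = √Real.pi / 2 := by
    have := Real.Gamma_add_one (s := 1 / 2) (by norm_num)
    rw [Real.Gamma_one_half_eq] at this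
    rw [show (((2 : ℕ) : ℝ) + 1) / 2 = 1 / 2 + 1 by norm_num, this]
    ring
  rw [← lintegral_add_compl _ (measurableSet_Ioi (a := (0 : ℝ))), compl_Ioi,
    ← setLIntegral_congr Iio_ae_eq_Iic, h2, h1, hG, ← ENNReal.ofReal_add (by positivity)
    (by positivity)]
  congr 1
  ring

theorem norm_sq_eq_coords (x : E3) : ‖x‖ ^ 2 = x 0 ^ 2 + x 1 ^ 2 + x 2 ^ 2 := by
  rw [EuclideanSpace.norm_sq_eq, Fin.sum_univ_three]
  simp

theorem inner_eq_coords (x y : E3) : ⟪x, y⟫ = x 0 * y 0 + x 1 * y 1 + x 2 * y 2 := by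
  rw [PiLp.inner_apply, Fin.sum_univ_three]
  simp [mul_comm]

/-- On a set of directions that is invariant under changes of the first coordinate of the cone
over it, the mean of the squared first coordinate is one third. -/
theorem three_mul_lintegral_sq_sphere {V : Set (Fin 2 → ℝ)} (hV : MeasurableSet V)
    (hcone : ∀ (r : ℝ) (p : Fin 2 → ℝ), 0 < r → (r • p ∈ V ↔ p ∈ V)) :
    3 * ∫⁻ d : Viewpoint, ENNReal.ofReal ((d : E3) 0 ^ 2) *
        V.indicator 1 (fun i : Fin 2 ↦ (d : E3) i.succ) ∂(volume : Measure E3).toSphere =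
      ∫⁻ d : Viewpoint, V.indicator 1 (fun i : Fin 2 ↦ (d : E3) i.succ)
        ∂(volume : Measure E3).toSphere := by
  have hind : ∀ (r : ℝ) (x : E3), 0 < r →
      V.indicator (1 : (Fin 2 → ℝ) → ℝ≥0∞) (fun i : Fin 2 ↦ (r • x) i.succ) =
        V.indicator (1 : (Fin 2 → ℝ) → ℝ≥0∞) (fun i : Fin 2 ↦ x i.succ) := by
    intro r x hr
    have := hcone r (fun i : Fin 2 ↦ x i.succ) hr
    have h2 : (fun i : Fin 2 ↦ (r • x) i.succ) = r • (fun i : Fin 2 ↦ x i.succ) := by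
      ext i; simp
    rw [h2]
    by_cases h : (fun i : Fin 2 ↦ x i.succ) ∈ V
    · rw [indicator_of_mem h, indicator_of_mem (this.2 h)]; rfl
    · rw [indicator_of_notMem h, indicator_of_notMem (fun h' ↦ h (this.1 h'))]
  have hmV : Measurable (V.indicator (1 : (Fin 2 → ℝ) → ℝ≥0∞)) := measurable_one.indicator hV
  set Φ0 : E3 → ℝ≥0∞ := fun x ↦ V.indicator 1 (fun i : Fin 2 ↦ x i.succ) with hΦ0
  set Φ2 : E3 → ℝ≥0∞ := fun x ↦ ENNReal.ofReal (x 0 ^ 2) * Φ0 x with hΦ2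
  have hm0 : Measurable Φ0 := hmV.comp (by fun_prop)
  have hm2 : Measurable Φ2 := by fun_prop
  have hh0 : PosHomogeneous 0 Φ0 := by
    intro r x hr
    simp only [hΦ0, hind r x hr]
    simp
  have hh2 : PosHomogeneous 2 Φ2 := by
    intro r x hr
    have : Φ0 (r • x) = Φ0 x := hind r x hr
    simp only [hΦ2, this]
    rw [← mul_assoc, ← ENNReal.ofReal_mul (by positivity)]
    congr 2
    simp [mul_pow]
  -- The Gaussian weight makes the first coordinate independent of the other two. Inserting its
  -- square multiplies the integral by `1/2`, whereas the radial moment grows by `3/2`; the quotient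
  -- is `1/3`. The common planar factor `B` is never divided out.
  set γ : ℝ → ℝ≥0∞ := fun r ↦ ENNReal.ofReal (Real.exp (-r ^ 2)) with hγ
  have hmγ : Measurable γ := by fun_prop
  have hprod : ∀ g : ℝ → ℝ≥0∞, Measurable g → ∫⁻ x : E3, g (x 0) * Φ0 x * γ ‖x‖ =
      (∫⁻ z : ℝ, g z * γ z) *
        ∫⁻ p : Fin 2 → ℝ, V.indicator 1 p * ENNReal.ofReal (Real.exp (-(p 0 ^ 2 + p 1 ^ 2))) := by
    intro g hg
    rw [← lintegral_prod_mul (by fun_prop) (by fun_prop), ← Measure.volume_eq_prod,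
      ← measurePreserving_coord_prod.lintegral_comp (by fun_prop)]
    apply lintegral_congr
    intro x
    have : γ ‖x‖ = γ (x 0) * ENNReal.ofReal (Real.exp (-(x 1 ^ 2 + x 2 ^ 2))) := by
      simp only [hγ]
      rw [← ENNReal.ofReal_mul (Real.exp_pos _).le, ← Real.exp_add, norm_sq_eq_coords]
      congr 2
      ring
    rw [this]
    simp only [hΦ0]
    have e1 : (Fin.succ 0 : Fin 3) = 1 := rfl
    have e2 : (Fin.succ 1 : Fin 3) = 2 := rfl
    rw [e1, e2]
    ring
  have k0 := hh0.lintegral_mul_norm hm0 hmγ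
  have k2 := hh2.lintegral_mul_norm hm2 hmγ
  have p0 := hprod 1 measurable_one
  have p2 := hprod (fun z ↦ ENNReal.ofReal (z ^ 2)) (by fun_prop)
  simp only [Pi.one_apply, one_mul] at p0
  rw [p0, lintegral_exp_neg_sq_pos, lintegral_Ioi_pow_mul_exp_neg_sq] at k0
  rw [p2, lintegral_sq_mul_exp_neg_sq, lintegral_Ioi_pow_mul_exp_neg_sq] at k2
  set B := ∫⁻ p : Fin 2 → ℝ, V.indicator 1 p * ENNReal.ofReal (Real.exp (-(p 0 ^ 2 + p 1 ^ 2)))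
  have g2 : Real.Gamma (((0 + 2 : ℕ) + 1) / 2) = √Real.pi / 2 := by
    have := Real.Gamma_add_one (s := 1 / 2) (by norm_num)
    rw [Real.Gamma_one_half_eq] at this
    rw [show (((0 + 2 : ℕ) : ℝ) + 1) / 2 = 1 / 2 + 1 by norm_num, this]
    ring
  have g4 : Real.Gamma (((2 + 2 : ℕ) + 1) / 2) = 3 / 2 * (√Real.pi / 2) := by
    have := Real.Gamma_add_one (s := 3 / 2) (by norm_num)
    rw [← g2, show (((2 + 2 : ℕ) : ℝ) + 1) / 2 = 3 / 2 + 1 by norm_num, this]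
    norm_num
  rw [g2] at k0
  rw [g4] at k2
  have hpi : 0 < √Real.pi := Real.sqrt_pos.2 Real.pi_pos
  have e0 : ENNReal.ofReal (√Real.pi) = 4 * ENNReal.ofReal (1 / 2 * (√Real.pi / 2)) := by
    rw [show (4 : ℝ≥0∞) = ENNReal.ofReal 4 by norm_num, ← ENNReal.ofReal_mul (by norm_num)]
    congr 1; ring
  have e1 : ENNReal.ofReal (√Real.pi / 2) = 2 * ENNReal.ofReal (1 / 2 * (√Real.pi / 2)) := by
    rw [show (2 : ℝ≥0∞) = ENNReal.ofReal 2 by norm_num, ← ENNReal.ofReal_mul (by norm_num)]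
    congr 1; ring
  have e2 : 2 * ENNReal.ofReal (1 / 2 * (3 / 2 * (√Real.pi / 2))) =
      3 * ENNReal.ofReal (1 / 2 * (√Real.pi / 2)) := by
    rw [show (2 : ℝ≥0∞) = ENNReal.ofReal 2 by norm_num, ← ENNReal.ofReal_mul (by norm_num),
      show (3 : ℝ≥0∞) = ENNReal.ofReal 3 by norm_num, ← ENNReal.ofReal_mul (by norm_num)]
    congr 1; ring
  have hc0 : ENNReal.ofReal (1 / 2 * (√Real.pi / 2)) ≠ 0 := by
    rw [ne_eq, ENNReal.ofReal_eq_zero, not_le]; positivity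
  refine (ENNReal.mul_left_inj hc0 ENNReal.ofReal_ne_top).1 ?_
  rw [← k0, e0]
  calc 3 * (∫⁻ d : Viewpoint, Φ2 d ∂(volume : Measure E3).toSphere) *
        ENNReal.ofReal (1 / 2 * (√Real.pi / 2)) =
      (∫⁻ d : Viewpoint, Φ2 d ∂(volume : Measure E3).toSphere) *
        (3 * ENNReal.ofReal (1 / 2 * (√Real.pi / 2))) := by ring
    _ = 2 * ((∫⁻ d : Viewpoint, Φ2 d ∂(volume : Measure E3).toSphere) *
        ENNReal.ofReal (1 / 2 * (3 / 2 * (√Real.pi / 2)))) := by rw [← e2]; ring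
    _ = _ := by rw [← k2, e1]; ring

theorem toSphere_univ_E3 : (volume : Measure E3).toSphere univ = ENNReal.ofReal (4 * Real.pi) := by
  rw [Measure.toSphere_apply_univ, EuclideanSpace.volume_ball_fin_three]
  have : Module.finrank ℝ E3 = 3 := by simp
  rw [this, show ((3 : ℕ) : ℝ≥0∞) = ENNReal.ofReal 3 by norm_num, ENNReal.ofReal_one, one_pow,
    one_mul, ← ENNReal.ofReal_mul (by norm_num)]
  congr 1; ring

theorem volume_annulus_le (A B : ℝ) (hA : 0 ≤ A) :
    volume {p : Fin 2 → ℝ | A < p 0 ^ 2 + p 1 ^ 2 ∧ p 0 ^ 2 + p 1 ^ 2 < B} ≤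
      ENNReal.ofReal (Real.pi * (B - A)) := by
  set s := {p : Fin 2 → ℝ | A < p 0 ^ 2 + p 1 ^ 2 ∧ p 0 ^ 2 + p 1 ^ 2 < B} with hs
  rcases lt_or_ge A B with hAB | hAB
  swap
  · have : s = ∅ := by
      ext p
      simp only [hs, mem_ofPred_eq, mem_empty_iff_false, iff_false]
      rintro ⟨h1, h2⟩
      linarith
    rw [this]; simp
  have hB : 0 < B := hA.trans_lt hAB
  have hms : MeasurableSet s :=
    (show MeasurableSet {p : Fin 2 → ℝ | A < p 0 ^ 2 + p 1 ^ 2} from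
      measurableSet_lt (by fun_prop) (by fun_prop)).inter
    (show MeasurableSet {p : Fin 2 → ℝ | p 0 ^ 2 + p 1 ^ 2 < B} from
      measurableSet_lt (by fun_prop) (by fun_prop))
  have hn : ∀ x : EuclideanSpace ℝ (Fin 2), ‖x‖ ^ 2 = x 0 ^ 2 + x 1 ^ 2 := by
    intro x
    rw [EuclideanSpace.norm_sq_eq, Fin.sum_univ_two]; simp
  rw [← (PiLp.volume_preserving_ofLp (Fin 2)).measure_preimage hms.nullMeasurableSet]
  have hsub : (@WithLp.ofLp 2 (Fin 2 → ℝ)) ⁻¹' s ⊆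
      Metric.ball (0 : EuclideanSpace ℝ (Fin 2)) √B \ Metric.closedBall 0 √A := by
    intro x hx
    have hx' : A < ‖x‖ ^ 2 ∧ ‖x‖ ^ 2 < B := by rw [hn]; exact hx
    simp only [mem_sdiff, Metric.mem_ball, Metric.mem_closedBall, dist_zero_right, not_le]
    exact ⟨Real.lt_sqrt_of_sq_lt hx'.2, (Real.sqrt_lt' ((norm_nonneg x).lt_of_ne' (by
      intro h; rw [h] at hx'; norm_num at hx'; linarith))).2 hx'.1⟩
  have hsub2 : Metric.closedBall (0 : EuclideanSpace ℝ (Fin 2)) √A ⊆ Metric.ball 0 √B :=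
    Metric.closedBall_subset_ball (Real.sqrt_lt_sqrt hA hAB)
  refine (measure_mono hsub).trans ?_
  rw [measure_sdiff hsub2 Metric.isClosed_closedBall.measurableSet.nullMeasurableSet
    measure_closedBall_lt_top.ne, EuclideanSpace.volume_ball_fin_two,
    EuclideanSpace.volume_closedBall_fin_two, ← ENNReal.ofReal_pow (by positivity),
    ← ENNReal.ofReal_pow (by positivity), Real.sq_sqrt hB.le, Real.sq_sqrt hA,
    ← ENNReal.ofReal_mul (by positivity), ← ENNReal.ofReal_mul (by positivity),
    ← ENNReal.ofReal_sub _ (by positivity)]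
  apply ENNReal.ofReal_le_ofReal
  linarith

/-- `ENNReal.ofReal` truncates the integrand to zero outside `[-τ, τ]`, so the integral over the
line is that of a parabolic cap. -/
theorem lintegral_parabola (τ : ℝ) (hτ : 0 < τ) :
    ∫⁻ z : ℝ, ENNReal.ofReal (Real.pi * (1 - z ^ 2 / τ ^ 2)) =
      ENNReal.ofReal (Real.pi * (4 * τ / 3)) := by
  have h1 : ∀ z : ℝ, ENNReal.ofReal (Real.pi * (1 - z ^ 2 / τ ^ 2)) =
      (Ioc (-τ) τ).indicator (fun z ↦ ENNReal.ofReal (Real.pi * (1 - z ^ 2 / τ ^ 2))) z := by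
    intro z
    by_cases h : z ∈ Ioc (-τ) τ
    · rw [indicator_of_mem h]
    · rw [indicator_of_notMem h, ENNReal.ofReal_eq_zero]
      have h2 : τ ^ 2 ≤ z ^ 2 := by
        rw [mem_Ioc, not_and_or, not_lt, not_le] at h
        rcases h with h | h <;> nlinarith
      have : 1 ≤ z ^ 2 / τ ^ 2 := by rwa [one_le_div (by positivity)]
      nlinarith [Real.pi_pos]
  rw [lintegral_congr h1, lintegral_indicator measurableSet_Ioc, ← ofReal_integral_eq_lintegral_ofReal,
    ← intervalIntegral.integral_of_le (by linarith)]
  · congr 1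
    rw [intervalIntegral.integral_const_mul]
    congr 1
    rw [intervalIntegral.integral_sub intervalIntegrable_const (by
      apply Continuous.intervalIntegrable; fun_prop)]
    simp only [intervalIntegral.integral_const, smul_eq_mul, mul_one,
      intervalIntegral.integral_div, integral_pow]
    have hτ' := hτ.ne'
    norm_num
    field_simp
    ring
  · exact (Continuous.integrableOn_Icc (by fun_prop)).mono_set Ioc_subset_Icc_self
  · filter_upwards [ae_restrict_mem measurableSet_Ioc] with z hz
    have h2 : z ^ 2 ≤ τ ^ 2 := sq_le_sq.2 (by rw [abs_of_pos hτ]; exact abs_le.2 ⟨hz.1.le, hz.2⟩)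
    have : z ^ 2 / τ ^ 2 ≤ 1 := by rwa [div_le_one (by positivity)]
    have := Real.pi_pos
    simp only [Pi.zero_apply]
    apply mul_nonneg <;> linarith

/-- Archimedes' bound for the measure of a zone of the sphere. -/
theorem toSphere_zone_le (τ : ℝ) (hτ : 0 < τ) :
    (volume : Measure E3).toSphere {d : Viewpoint | (d : E3) 0 ^ 2 < τ ^ 2} ≤
      ENNReal.ofReal τ * (volume : Measure E3).toSphere univ := by
  rcases le_or_gt 1 τ with h1 | h1
  · calc _ ≤ (volume : Measure E3).toSphere univ := measure_mono (subset_univ _)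
      _ ≤ _ := by
        apply le_mul_of_one_le_left (by simp)
        rw [← ENNReal.ofReal_one]
        exact ENNReal.ofReal_le_ofReal h1
  -- The cone over the zone: a third of the measure of the zone is the volume of its part in the
  -- unit ball, which is computed by slices.
  set s : Set E3 := {x | x 0 ^ 2 < τ ^ 2 * ‖x‖ ^ 2} with hs
  have hms : MeasurableSet s := measurableSet_lt (by fun_prop) (by fun_prop)
  have hh : PosHomogeneous 0 (s.indicator 1) := by
    intro r x hr
    have : r • x ∈ s ↔ x ∈ s := by
      simp only [hs, mem_ofPred_eq, PiLp.smul_apply, smul_eq_mul, norm_smul, mul_pow,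
        Real.norm_eq_abs, sq_abs]
      rw [show τ ^ 2 * (r ^ 2 * ‖x‖ ^ 2) = r ^ 2 * (τ ^ 2 * ‖x‖ ^ 2) by ring]
      exact mul_lt_mul_iff_right₀ (by positivity)
    by_cases h : x ∈ s
    · rw [indicator_of_mem h, indicator_of_mem (this.2 h)]; simp
    · rw [indicator_of_notMem h, indicator_of_notMem (fun h' ↦ h (this.1 h'))]; simp
  have hγ : Measurable ((Iio (1 : ℝ)).indicator (1 : ℝ → ℝ≥0∞)) :=
    measurable_one.indicator measurableSet_Iio
  have key := hh.lintegral_mul_norm (measurable_one.indicator hms) hγ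
  rw [lintegral_Ioi_pow_mul_indicator] at key
  have hsph : ∫⁻ d : Viewpoint, s.indicator 1 (d : E3) ∂(volume : Measure E3).toSphere =
      (volume : Measure E3).toSphere {d : Viewpoint | (d : E3) 0 ^ 2 < τ ^ 2} := by
    rw [← lintegral_indicator_one (measurableSet_lt (by fun_prop) (by fun_prop))]
    apply lintegral_congr
    intro d
    have hd : ‖(d : E3)‖ = 1 := by simp
    simp [indicator, hs]
  rw [hsph] at key
  have hball : ∫⁻ x : E3, s.indicator 1 x * (Iio (1 : ℝ)).indicator 1 ‖x‖ ≤
      ENNReal.ofReal (Real.pi * (4 * τ / 3)) := by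
    rw [← lintegral_parabola τ hτ]
    -- The slice at height `z` is the annulus with squared radii `a z²` and `1 - z²`; since `a + 1 =
    -- 1 / τ²`, its area is `π (1 - z² / τ²)` when nonempty.
    set a : ℝ := (1 - τ ^ 2) / τ ^ 2 with ha
    have ha0 : 0 ≤ a := div_nonneg (by nlinarith) (by positivity)
    set R : Set (ℝ × (Fin 2 → ℝ)) := {q | a * q.1 ^ 2 < q.2 0 ^ 2 + q.2 1 ^ 2 ∧
      q.2 0 ^ 2 + q.2 1 ^ 2 < 1 - q.1 ^ 2} with hR
    have hmR : MeasurableSet R :=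
      (show MeasurableSet {q : ℝ × (Fin 2 → ℝ) | a * q.1 ^ 2 < q.2 0 ^ 2 + q.2 1 ^ 2} from
        measurableSet_lt (by fun_prop) (by fun_prop)).inter
      (show MeasurableSet {q : ℝ × (Fin 2 → ℝ) | q.2 0 ^ 2 + q.2 1 ^ 2 < 1 - q.1 ^ 2} from
        measurableSet_lt (by fun_prop) (by fun_prop))
    calc ∫⁻ x : E3, s.indicator 1 x * (Iio (1 : ℝ)).indicator 1 ‖x‖
        ≤ ∫⁻ x : E3, R.indicator 1 ((x 0, fun i : Fin 2 ↦ x i.succ) : ℝ × (Fin 2 → ℝ)) := by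
          apply lintegral_mono
          intro x
          by_cases h : x ∈ s
          swap
          · simp [h]
          by_cases h' : ‖x‖ ∈ Iio (1 : ℝ)
          swap
          · simp [h']
          beta_reduce
          rw [indicator_of_mem (s := R)]
          · simp [h, h']
          · have e1 : (Fin.succ 0 : Fin 3) = 1 := rfl
            have e2 : (Fin.succ 1 : Fin 3) = 2 := rfl
            simp only [hR, mem_ofPred_eq, e1, e2]
            simp only [hs, mem_ofPred_eq] at h
            have h3 : ‖x‖ ^ 2 < 1 := by
              have : ‖x‖ < 1 := h'
              nlinarith [norm_nonneg x]
            rw [norm_sq_eq_coords] at h h3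
            constructor
            · rw [ha, div_mul_eq_mul_div, div_lt_iff₀ (by positivity)]
              linarith
            · linarith
      _ = ∫⁻ q, R.indicator 1 q := measurePreserving_coord_prod.lintegral_comp
          (measurable_one.indicator hmR)
      _ = ∫⁻ z : ℝ, volume {p : Fin 2 → ℝ | a * z ^ 2 < p 0 ^ 2 + p 1 ^ 2 ∧
          p 0 ^ 2 + p 1 ^ 2 < 1 - z ^ 2} := by
          rw [lintegral_indicator_one hmR, Measure.volume_eq_prod, Measure.prod_apply hmR]
          rfl
      _ ≤ ∫⁻ z : ℝ, ENNReal.ofReal (Real.pi * (1 - z ^ 2 / τ ^ 2)) := by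
          apply lintegral_mono
          intro z
          refine (volume_annulus_le _ _ (by positivity)).trans (ENNReal.ofReal_le_ofReal ?_)
          rw [ha]
          apply le_of_eq
          field_simp
          ring
  rw [key] at hball
  rw [toSphere_univ_E3, ← ENNReal.ofReal_mul hτ.le]
  have h13 : ENNReal.ofReal (1 / (((0 + 2 : ℕ) : ℝ) + 1)) ≠ 0 := by
    rw [ne_eq, ENNReal.ofReal_eq_zero]; norm_num
  refine (ENNReal.mul_le_mul_iff_left h13 ENNReal.ofReal_ne_top).1 (hball.trans ?_)
  rw [← ENNReal.ofReal_mul (by positivity)]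
  apply ENNReal.ofReal_le_ofReal
  norm_num
  linarith

/-! ### Probabilities of double wedges, zones and planes. -/

theorem posHomogeneous_indicator {s : Set E3}
    (hs : ∀ (r : ℝ) (x : E3), 0 < r → (r • x ∈ s ↔ x ∈ s)) :
    PosHomogeneous 0 (s.indicator 1) := by
  intro r x hr
  by_cases h : x ∈ s
  · rw [indicator_of_mem h, indicator_of_mem ((hs r x hr).2 h)]; simp
  · rw [indicator_of_notMem h, indicator_of_notMem (fun h' ↦ h ((hs r x hr).1 h'))]; simp

theorem posHomogeneous_coord_sq (i : Fin 3) :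
    PosHomogeneous 2 (fun x ↦ ENNReal.ofReal (x i ^ 2)) := by
  intro r x hr
  simp only
  rw [← ENNReal.ofReal_mul (by positivity)]
  simp [mul_pow]

theorem PosHomogeneous.mul {k l : ℕ} {Φ Ψ : E3 → ℝ≥0∞} (hΦ : PosHomogeneous k Φ)
    (hΨ : PosHomogeneous l Ψ) : PosHomogeneous (k + l) (fun x ↦ Φ x * Ψ x) := by
  intro r x hr
  simp only [hΦ r x hr, hΨ r x hr]
  rw [pow_add, ENNReal.ofReal_mul (by positivity)]
  ring

theorem smul_mem_zone_iff (τ : ℝ) (i : Fin 3) (r : ℝ) (x : E3) (hr : 0 < r) :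
    r • x ∈ {x : E3 | x i ^ 2 < τ ^ 2 * ‖x‖ ^ 2} ↔ x ∈ {x : E3 | x i ^ 2 < τ ^ 2 * ‖x‖ ^ 2} := by
  simp only [mem_ofPred_eq, PiLp.smul_apply, smul_eq_mul, norm_smul, mul_pow,
    Real.norm_eq_abs, sq_abs]
  rw [show τ ^ 2 * (r ^ 2 * ‖x‖ ^ 2) = r ^ 2 * (τ ^ 2 * ‖x‖ ^ 2) by ring]
  exact mul_lt_mul_iff_right₀ (by positivity)

theorem toSphere_univ_ne_zero : (volume : Measure E3).toSphere univ ≠ 0 := by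
  rw [ne_eq, Measure.measure_univ_eq_zero]
  exact Measure.toSphere_ne_zero _

theorem lintegral_uniformViewpoint (F : Viewpoint → ℝ≥0∞) :
    ∫⁻ d, F d ∂uniformViewpoint = ((volume : Measure E3).toSphere univ)⁻¹ *
      ∫⁻ d, F d ∂(volume : Measure E3).toSphere := by
  rw [uniformViewpoint, lintegral_smul_measure, smul_eq_mul]

instance : IsProbabilityMeasure uniformViewpoint where
  measure_univ := by
    rw [uniformViewpoint, Measure.smul_apply, smul_eq_mul]
    exact ENNReal.inv_mul_cancel toSphere_univ_ne_zero (measure_ne_top _ _)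

theorem exists_orthonormalBasis_zero (e : E3) (he : ‖e‖ = 1) :
    ∃ b : OrthonormalBasis (Fin 3) ℝ E3, b 0 = e := by
  have ho : Orthonormal ℝ (({0} : Set (Fin 3)).domRestrict (fun _ : Fin 3 ↦ e)) := by
    constructor
    · intro i; simpa [domRestrict] using he
    · intro i j hij
      exact absurd (Subsingleton.elim i j) hij
  obtain ⟨b, hb⟩ := ho.exists_orthonormalBasis_extension_of_card_eq (by simp)
  exact ⟨b, hb 0 rfl⟩

theorem exists_orthonormalBasis_zero_one (n e : E3) (hn : ‖n‖ = 1) (he : ‖e‖ = 1)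
    (h : ⟪n, e⟫ = 0) : ∃ b : OrthonormalBasis (Fin 3) ℝ E3, b 0 = n ∧ b 1 = e := by
  have ho : Orthonormal ℝ (({0, 1} : Set (Fin 3)).domRestrict ![n, e, 0]) := by
    constructor
    · rintro ⟨i, rfl | rfl⟩ <;> simpa [domRestrict]
    · rintro ⟨i, rfl | rfl⟩ ⟨j, rfl | rfl⟩ hij
      · exact absurd rfl hij
      · simpa [domRestrict] using h
      · simpa [domRestrict, real_inner_comm] using h
      · exact absurd rfl hij
  obtain ⟨b, hb⟩ := ho.exists_orthonormalBasis_extension_of_card_eq (by simp)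
  exact ⟨b, hb 0 (by simp), hb 1 (by simp)⟩

/-- The directions from which exactly one of the planes with normals `n`, `n'` is seen from its
positive side. -/
def doubleWedge (n n' : E3) : Set E3 := {d | ⟪n, d⟫ * ⟪n', d⟫ < 0}

theorem measurableSet_doubleWedge (n n' : E3) : MeasurableSet (doubleWedge n n') :=
  measurableSet_lt (by fun_prop) (by fun_prop)

theorem smul_mem_doubleWedge (n n' : E3) (r : ℝ) (x : E3) (hr : 0 < r) :
    r • x ∈ doubleWedge n n' ↔ x ∈ doubleWedge n n' := by
  simp only [doubleWedge, mem_ofPred_eq, inner_smul_right]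
  rw [show r * ⟪n, x⟫ * (r * ⟪n', x⟫) = r ^ 2 * (⟪n, x⟫ * ⟪n', x⟫) by ring]
  constructor
  · intro h
    by_contra h'
    have : 0 ≤ r ^ 2 * (⟪n, x⟫ * ⟪n', x⟫) := mul_nonneg (by positivity) (not_lt.1 h')
    linarith
  · intro h
    exact mul_neg_of_pos_of_neg (by positivity) h

/-- The directions of a double wedge around the axis `e` make with `e` an angle whose squared sine
has mean two thirds. -/
theorem uniformViewpoint_doubleWedge (e n n' : E3) (he : ‖e‖ = 1) (hn : ⟪e, n⟫ = 0)
    (hn' : ⟪e, n'⟫ = 0) :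
    ∫⁻ d : Viewpoint, (doubleWedge n n').indicator 1 (d : E3) ∂uniformViewpoint =
      ENNReal.ofReal (3 / 2) * ∫⁻ d : Viewpoint, ENNReal.ofReal (1 - ⟪e, d⟫ ^ 2) *
        (doubleWedge n n').indicator 1 (d : E3) ∂uniformViewpoint := by
  obtain ⟨b, hb⟩ := exists_orthonormalBasis_zero e he
  set m := b.repr n with hm
  set m' := b.repr n' with hm'
  have hm0 : m 0 = 0 := by rw [hm, b.repr_apply_apply, hb, hn]
  have hm0' : m' 0 = 0 := by rw [hm', b.repr_apply_apply, hb, hn']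
  set V : Set (Fin 2 → ℝ) := {p | (m 1 * p 0 + m 2 * p 1) * (m' 1 * p 0 + m' 2 * p 1) < 0} with hV
  have hmV : MeasurableSet V := measurableSet_lt (by fun_prop) (by fun_prop)
  have hVW : ∀ x : E3, (fun i : Fin 2 ↦ x i.succ) ∈ V ↔ x ∈ doubleWedge m m' := by
    intro x
    simp only [hV, doubleWedge, mem_ofPred_eq, inner_eq_coords, hm0, hm0']
    have e1 : (Fin.succ 0 : Fin 3) = 1 := rfl
    have e2 : (Fin.succ 1 : Fin 3) = 2 := rfl
    simp only [e1, e2, zero_mul, zero_add]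
  have hVi : ∀ x : E3, V.indicator (1 : (Fin 2 → ℝ) → ℝ≥0∞) (fun i : Fin 2 ↦ x i.succ) =
      (doubleWedge m m').indicator 1 x := by
    intro x
    by_cases h : x ∈ doubleWedge m m'
    · rw [indicator_of_mem h, indicator_of_mem ((hVW x).2 h)]; rfl
    · rw [indicator_of_notMem h, indicator_of_notMem (fun h' ↦ h ((hVW x).1 h'))]
  have hcone : ∀ (r : ℝ) (p : Fin 2 → ℝ), 0 < r → (r • p ∈ V ↔ p ∈ V) := by
    intro r p hr
    have h1 := smul_mem_doubleWedge m m' r (!₂[0, p 0, p 1]) hr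
    rw [← hVW, ← hVW] at h1
    convert! h1 using 2
    · ext i; fin_cases i <;> simp
    · ext i; fin_cases i <;> simp
  have key := three_mul_lintegral_sq_sphere hmV hcone
  simp only [hVi] at key
  have hWb : ∀ x : E3, b.repr x ∈ doubleWedge m m' ↔ x ∈ doubleWedge n n' := by
    intro x
    simp only [doubleWedge, mem_ofPred_eq, hm, hm', LinearIsometryEquiv.inner_map_map]
  have hWi : ∀ x : E3, (doubleWedge m m').indicator (1 : E3 → ℝ≥0∞) (b.repr x) =
      (doubleWedge n n').indicator 1 x := by
    intro x
    by_cases h : x ∈ doubleWedge n n'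
    · rw [indicator_of_mem h, indicator_of_mem ((hWb x).2 h)]; rfl
    · rw [indicator_of_notMem h, indicator_of_notMem (fun h' ↦ h ((hWb x).1 h'))]
  have h0 : PosHomogeneous 0 ((doubleWedge m m').indicator 1) :=
    posHomogeneous_indicator (smul_mem_doubleWedge m m')
  have hi0 : Measurable ((doubleWedge m m').indicator (1 : E3 → ℝ≥0∞)) :=
    measurable_one.indicator (measurableSet_doubleWedge m m')
  have hin : Measurable ((doubleWedge n n').indicator (1 : E3 → ℝ≥0∞)) :=
    measurable_one.indicator (measurableSet_doubleWedge n n')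
  have t0 := h0.lintegral_sphere_repr hi0 b
  have t2 := ((posHomogeneous_coord_sq 0).mul h0).lintegral_sphere_repr (by fun_prop) b
  simp only [hWi, b.repr_apply_apply, hb] at t0 t2
  rw [← t0, ← t2] at key
  set I0 := ∫⁻ d : Viewpoint, (doubleWedge n n').indicator 1 (d : E3)
    ∂(volume : Measure E3).toSphere with hI0
  set I2 := ∫⁻ d : Viewpoint, ENNReal.ofReal (⟪e, d⟫ ^ 2) * (doubleWedge n n').indicator 1 (d : E3)
    ∂(volume : Measure E3).toSphere with hI2
  have hfin : I2 ≠ ∞ := by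
    have : I0 ≠ ∞ := by
      rw [hI0]
      refine ((lintegral_mono (g := fun _ ↦ (1 : ℝ≥0∞)) ?_).trans_lt ?_).ne
      · intro d
        exact indicator_le_self' (by simp) _
      · simp only [lintegral_const, one_mul]
        exact measure_lt_top _ _
    intro h
    rw [h] at key
    apply this
    rw [← key]
    simp
  have hsum : I0 = (∫⁻ d : Viewpoint, ENNReal.ofReal (1 - ⟪e, d⟫ ^ 2) *
      (doubleWedge n n').indicator 1 (d : E3) ∂(volume : Measure E3).toSphere) + I2 := by
    rw [hI2, ← lintegral_add_right _ (by fun_prop)]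
    apply lintegral_congr
    intro d
    have h1 : ⟪e, (d : E3)⟫ ^ 2 ≤ 1 := by
      have h := abs_real_inner_le_norm e (d : E3)
      have hd : ‖(d : E3)‖ = 1 := by simp
      rw [he, hd, one_mul] at h
      rw [← sq_abs]
      exact pow_le_one₀ (abs_nonneg _) h
    rw [← add_mul, ← ENNReal.ofReal_add (by linarith) (by positivity)]
    simp
  rw [lintegral_uniformViewpoint, lintegral_uniformViewpoint, ← hI0]
  set J := ∫⁻ d : Viewpoint, ENNReal.ofReal (1 - ⟪e, d⟫ ^ 2) *
      (doubleWedge n n').indicator 1 (d : E3) ∂(volume : Measure E3).toSphere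
  -- From `I0 = J + I2` and `3 * I2 = I0`; cancelling `I2` needs its finiteness.
  have hJ : J = 2 * I2 := by
    rw [← key, show (3 : ℝ≥0∞) = 2 + 1 by norm_num, add_mul, one_mul] at hsum
    exact ((ENNReal.add_left_inj hfin).1 hsum).symm
  rw [hJ, ← key]
  have : (3 : ℝ≥0∞) = ENNReal.ofReal (3 / 2) * 2 := by
    rw [show (2 : ℝ≥0∞) = ENNReal.ofReal 2 by norm_num, ← ENNReal.ofReal_mul (by norm_num)]
    norm_num
  rw [this]
  ring

/-- Exchanging the coordinates `1` and `2` preserves the zone, so twice the integral is the measure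
of the zone plus the moment of the first coordinate, which is at most `τ²` times that measure. -/
theorem toSphere_zone_moment_le (τ : ℝ) (hτ : 0 < τ) (hτ' : τ ≤ 1 / 2) :
    ∫⁻ d : Viewpoint, ENNReal.ofReal ((d : E3) 0 ^ 2 + (d : E3) 2 ^ 2) *
      {x : E3 | x 0 ^ 2 < τ ^ 2 * ‖x‖ ^ 2}.indicator 1 (d : E3) ∂(volume : Measure E3).toSphere ≤
      ENNReal.ofReal (2 / 3 * τ) * (volume : Measure E3).toSphere univ := by
  set s := {x : E3 | x 0 ^ 2 < τ ^ 2 * ‖x‖ ^ 2} with hs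
  have hms : MeasurableSet s := measurableSet_lt (by fun_prop) (by fun_prop)
  have hi : Measurable (s.indicator (1 : E3 → ℝ≥0∞)) := measurable_one.indicator hms
  have hh : PosHomogeneous 0 (s.indicator 1) := posHomogeneous_indicator (smul_mem_zone_iff τ 0)
  set I : Fin 3 → ℝ≥0∞ := fun i ↦ ∫⁻ d : Viewpoint, ENNReal.ofReal ((d : E3) i ^ 2) *
    s.indicator 1 (d : E3) ∂(volume : Measure E3).toSphere with hI
  set P := ∫⁻ d : Viewpoint, s.indicator 1 (d : E3) ∂(volume : Measure E3).toSphere with hP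
  have hd : ∀ d : Viewpoint, (d : E3) 0 ^ 2 + (d : E3) 1 ^ 2 + (d : E3) 2 ^ 2 = 1 := by
    intro d
    have hd : ‖(d : E3)‖ = 1 := by simp
    rw [← norm_sq_eq_coords, hd, one_pow]
  have hPle : P ≤ ENNReal.ofReal τ * (volume : Measure E3).toSphere univ := by
    refine le_of_eq_of_le ?_ (toSphere_zone_le τ hτ)
    rw [hP, ← lintegral_indicator_one (measurableSet_lt (by fun_prop) (by fun_prop))]
    apply lintegral_congr
    intro d
    have hd : ‖(d : E3)‖ = 1 := by simp
    simp [indicator, hs]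
  have hsumP : P = I 0 + (I 1 + I 2) := by
    simp only [hI]
    rw [← lintegral_add_right _ (by fun_prop), ← lintegral_add_right _ (by fun_prop)]
    apply lintegral_congr
    intro d
    rw [← add_mul, ← add_mul, ← ENNReal.ofReal_add (by positivity) (by positivity),
      ← ENNReal.ofReal_add (by positivity) (by positivity), ← add_assoc, hd d]
    simp
  have hI0 : I 0 ≤ ENNReal.ofReal (τ ^ 2) * P := by
    rw [hP, ← lintegral_const_mul _ (by fun_prop)]
    apply lintegral_mono
    intro d
    by_cases h : (d : E3) ∈ s
    · simp only [h, indicator_of_mem, Pi.one_apply, mul_one]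
      have hd : ‖(d : E3)‖ = 1 := by simp
      have h' : (d : E3) 0 ^ 2 < τ ^ 2 * ‖(d : E3)‖ ^ 2 := h
      rw [hd] at h'
      exact ENNReal.ofReal_le_ofReal (by linarith)
    · simp [h]
  have h12 : I 1 = I 2 := by
    set b : OrthonormalBasis (Fin 3) ℝ E3 :=
      (EuclideanSpace.basisFun (Fin 3) ℝ).reindex (Equiv.swap 1 2) with hb
    have hrepr : ∀ (x : E3) (i : Fin 3), b.repr x i = x (Equiv.swap 1 2 i) := by
      intro x i
      rw [hb, OrthonormalBasis.repr_reindex]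
      simp
    have t := ((posHomogeneous_coord_sq 2).mul hh).lintegral_sphere_repr (by fun_prop) b
    have hbs : ∀ x : E3, s.indicator (1 : E3 → ℝ≥0∞) (b.repr x) = s.indicator 1 x := by
      intro x
      have : b.repr x ∈ s ↔ x ∈ s := by
        simp only [hs, mem_ofPred_eq, hrepr, LinearIsometryEquiv.norm_map]
        rfl
      by_cases h : x ∈ s
      · rw [indicator_of_mem h, indicator_of_mem (this.2 h)]; rfl
      · rw [indicator_of_notMem h, indicator_of_notMem (fun h' ↦ h (this.1 h'))]
    simp only [hbs, hrepr] at t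
    simp only [hI]
    rw [← t]
    rfl
  have hgoal : ∫⁻ d : Viewpoint, ENNReal.ofReal ((d : E3) 0 ^ 2 + (d : E3) 2 ^ 2) *
      s.indicator 1 (d : E3) ∂(volume : Measure E3).toSphere = I 0 + I 2 := by
    simp only [hI]
    rw [← lintegral_add_right _ (by fun_prop)]
    apply lintegral_congr
    intro d
    rw [← add_mul, ← ENNReal.ofReal_add (by positivity) (by positivity)]
  rw [hgoal]
  have h2 : 2 * (I 0 + I 2) ≤ 2 * (ENNReal.ofReal (2 / 3 * τ) *
      (volume : Measure E3).toSphere univ) := by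
    calc 2 * (I 0 + I 2) = I 0 + P := by rw [hsumP, h12]; ring
      _ ≤ ENNReal.ofReal (τ ^ 2) * P + P := by gcongr
      _ = (ENNReal.ofReal (τ ^ 2) + 1) * P := by ring
      -- As `τ ≤ 1/2`, even `5/4` would do; `4/3` leads to the factor `2/3` that cancels the `3/2`
      -- of the wedge formula.
      _ ≤ ENNReal.ofReal (4 / 3) * P := by
        gcongr
        rw [← ENNReal.ofReal_one, ← ENNReal.ofReal_add (by positivity) (by positivity)]
        apply ENNReal.ofReal_le_ofReal
        nlinarith
      _ ≤ ENNReal.ofReal (4 / 3) * (ENNReal.ofReal τ * (volume : Measure E3).toSphere univ) := by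
        gcongr
      _ = _ := by
        have h43 : ENNReal.ofReal (4 / 3 * τ) = 2 * ENNReal.ofReal (2 / 3 * τ) := by
          rw [show (2 : ℝ≥0∞) = ENNReal.ofReal 2 by norm_num, ← ENNReal.ofReal_mul (by norm_num)]
          congr 1; ring
        rw [← mul_assoc, ← mul_assoc, ← ENNReal.ofReal_mul (by norm_num), h43]
  exact (ENNReal.mul_le_mul_iff_right (by norm_num) (by norm_num)).1 h2

/-- The mean over a zone around the great circle orthogonal to `n` of the squared sine of the angle
with a direction `e` of that circle. -/
theorem uniformViewpoint_zone_moment_le (n e : E3) (hn : n ≠ 0) (he : ‖e‖ = 1) (hne : ⟪e, n⟫ = 0)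
    (τ : ℝ) (hτ : 0 < τ) (hτ' : τ ≤ 1 / 2) :
    ∫⁻ d : Viewpoint, ENNReal.ofReal (1 - ⟪e, d⟫ ^ 2) *
      {x : E3 | |⟪n, x⟫| < τ * ‖n‖}.indicator 1 (d : E3) ∂uniformViewpoint ≤
      ENNReal.ofReal (2 / 3 * τ) := by
  have hn0 : 0 < ‖n‖ := norm_pos_iff.2 hn
  set ν : E3 := ‖n‖⁻¹ • n with hν
  have hν1 : ‖ν‖ = 1 := by rw [hν, norm_smul]; simp [hn0.ne']
  obtain ⟨b, hb0, hb1⟩ := exists_orthonormalBasis_zero_one ν e hν1 he (by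
    rw [hν, inner_smul_left, real_inner_comm, hne, mul_zero])
  set s := {x : E3 | x 0 ^ 2 < τ ^ 2 * ‖x‖ ^ 2} with hs
  have hms : MeasurableSet s := measurableSet_lt (by fun_prop) (by fun_prop)
  have hi : Measurable (s.indicator (1 : E3 → ℝ≥0∞)) := measurable_one.indicator hms
  have hh : PosHomogeneous 0 (s.indicator 1) := posHomogeneous_indicator (smul_mem_zone_iff τ 0)
  have hq : PosHomogeneous 2 (fun x : E3 ↦ ENNReal.ofReal (x 0 ^ 2 + x 2 ^ 2)) := by
    intro r x hr
    simp only
    rw [← ENNReal.ofReal_mul (by positivity)]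
    congr 1
    simp only [PiLp.smul_apply, smul_eq_mul]
    ring
  have t := (hq.mul hh).lintegral_sphere_repr (by fun_prop) b
  have hle := toSphere_zone_moment_le τ hτ hτ'
  rw [← t] at hle
  rw [lintegral_uniformViewpoint]
  have hcongr : ∫⁻ d : Viewpoint, ENNReal.ofReal (1 - ⟪e, d⟫ ^ 2) *
      {x : E3 | |⟪n, x⟫| < τ * ‖n‖}.indicator 1 (d : E3) ∂(volume : Measure E3).toSphere =
      ∫⁻ d : Viewpoint, ENNReal.ofReal ((b.repr (d : E3)) 0 ^ 2 + (b.repr (d : E3)) 2 ^ 2) *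
        s.indicator 1 (b.repr (d : E3)) ∂(volume : Measure E3).toSphere := by
    apply lintegral_congr
    intro d
    have hd : ‖(d : E3)‖ = 1 := by simp
    have h1 : (b.repr (d : E3)) 0 ^ 2 + (b.repr (d : E3)) 2 ^ 2 = 1 - ⟪e, (d : E3)⟫ ^ 2 := by
      have := norm_sq_eq_coords (b.repr (d : E3))
      rw [LinearIsometryEquiv.norm_map, hd] at this
      have h2 : b.repr (d : E3) 1 = ⟪e, (d : E3)⟫ := by rw [b.repr_apply_apply, hb1]
      rw [h2] at this
      linarith
    have h3 : b.repr (d : E3) ∈ s ↔ (d : E3) ∈ {x : E3 | |⟪n, x⟫| < τ * ‖n‖} := by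
      simp only [hs, mem_ofPred_eq, LinearIsometryEquiv.norm_map, hd, b.repr_apply_apply, hb0]
      rw [one_pow, mul_one, sq_lt_sq, abs_of_pos hτ, hν, real_inner_smul_left, abs_mul, abs_inv,
        abs_norm, inv_mul_lt_iff₀ hn0, mul_comm]
    rw [h1]
    congr 1
    by_cases h : b.repr (d : E3) ∈ s
    · rw [indicator_of_mem h, indicator_of_mem (h3.1 h)]; rfl
    · rw [indicator_of_notMem h, indicator_of_notMem (fun h' ↦ h (h3.2 h'))]
  rw [hcongr]
  calc _ ≤ ((volume : Measure E3).toSphere univ)⁻¹ * (ENNReal.ofReal (2 / 3 * τ) *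
        (volume : Measure E3).toSphere univ) := by gcongr
    _ = ENNReal.ofReal (2 / 3 * τ) * (((volume : Measure E3).toSphere univ)⁻¹ *
        (volume : Measure E3).toSphere univ) := by ring
    _ = _ := by rw [ENNReal.inv_mul_cancel toSphere_univ_ne_zero (measure_ne_top _ _), mul_one]

open scoped Pointwise in
-- The cone over this set of directions stays in a proper subspace, which is Lebesgue null.
theorem ae_notMem_submodule (p : Submodule ℝ E3) (hp : p ≠ ⊤) :
    ∀ᵐ d : Viewpoint ∂uniformViewpoint, (d : E3) ∉ p := by
  have hm : MeasurableSet {d : Viewpoint | (d : E3) ∈ p} :=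
    (p.closed_of_finiteDimensional.measurableSet).preimage measurable_subtype_coe
  rw [ae_iff]
  simp only [not_not]
  rw [uniformViewpoint, Measure.smul_apply, Measure.toSphere_apply' _ hm]
  have : volume (Ioo (0 : ℝ) 1 • ((↑) '' {d : Viewpoint | (d : E3) ∈ p} : Set E3)) = 0 := by
    apply measure_mono_null _ (Measure.addHaar_submodule volume p hp)
    rintro _ ⟨r, -, _, ⟨d, hd, rfl⟩, rfl⟩
    exact p.smul_mem r hd
  rw [this]
  simp

/-! ### Cross products and projection along a direction. -/

/-- The cross product on Euclidean three-space. -/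
def cr (u v : E3) : E3 := WithLp.toLp 2 (WithLp.ofLp u ⨯₃ WithLp.ofLp v)

theorem faceNormal_eq_cr (a b c : E3) : faceNormal a b c = cr (b - a) (c - a) := rfl

@[simp] theorem cr_apply_zero (u v : E3) : cr u v 0 = u 1 * v 2 - u 2 * v 1 := by
  simp [cr, cross_apply]

@[simp] theorem cr_apply_one (u v : E3) : cr u v 1 = u 2 * v 0 - u 0 * v 2 := by
  simp [cr, cross_apply]

@[simp] theorem cr_apply_two (u v : E3) : cr u v 2 = u 0 * v 1 - u 1 * v 0 := by
  simp [cr, cross_apply]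

theorem E3_ext {u v : E3} (h0 : u 0 = v 0) (h1 : u 1 = v 1) (h2 : u 2 = v 2) : u = v := by
  ext i; fin_cases i <;> assumption

theorem inner_cr_left (u v : E3) : ⟪u, cr u v⟫ = 0 := by
  simp only [inner_eq_coords, cr_apply_zero, cr_apply_one, cr_apply_two]; ring

theorem inner_cr_right (u v : E3) : ⟪v, cr u v⟫ = 0 := by
  simp only [inner_eq_coords, cr_apply_zero, cr_apply_one, cr_apply_two]; ring

theorem inner_cr_rotate (u v w : E3) : ⟪u, cr v w⟫ = ⟪cr u v, w⟫ := by
  simp only [inner_eq_coords, cr_apply_zero, cr_apply_one, cr_apply_two]; ring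

theorem norm_cr_sq (u v : E3) : ‖cr u v‖ ^ 2 = ‖u‖ ^ 2 * ‖v‖ ^ 2 - ⟪u, v⟫ ^ 2 := by
  simp only [norm_sq_eq_coords, inner_eq_coords, cr_apply_zero, cr_apply_one, cr_apply_two]; ring

theorem norm_cr_le (u v : E3) : ‖cr u v‖ ≤ ‖u‖ * ‖v‖ := by
  apply le_of_sq_le_sq _ (by positivity)
  rw [norm_cr_sq, mul_pow]
  nlinarith [sq_nonneg ⟪u, v⟫]

theorem cr_neg_left (u v : E3) : cr (-u) v = -cr u v := by
  apply E3_ext <;> simp <;> ring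

theorem projAlong_neg (d u : E3) : projAlong d (-u) = -projAlong d u := by
  simp only [projAlong, inner_neg_left, neg_smul]; abel

theorem norm_projAlong_sq {d : E3} (hd : ‖d‖ = 1) (e : E3) :
    ‖projAlong d e‖ ^ 2 = ‖e‖ ^ 2 - ⟪e, d⟫ ^ 2 := by
  rw [projAlong, norm_sub_sq_real, inner_smul_right, norm_smul, hd, Real.norm_eq_abs, mul_one,
    sq_abs]
  ring

theorem norm_projAlong {d : E3} (hd : ‖d‖ = 1) (e : E3) : ‖projAlong d e‖ = ‖cr e d‖ := by
  rw [← sq_eq_sq₀ (norm_nonneg _) (norm_nonneg _), norm_projAlong_sq hd, norm_cr_sq, hd]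
  ring

theorem norm_projAlong_le {d : E3} (hd : ‖d‖ = 1) (e : E3) : ‖projAlong d e‖ ≤ ‖e‖ := by
  rw [norm_projAlong hd]
  simpa [hd] using norm_cr_le e d

theorem inner_self_projAlong {d : E3} (hd : ‖d‖ = 1) (e : E3) :
    ⟪e, projAlong d e⟫ = ‖projAlong d e‖ ^ 2 := by
  rw [norm_projAlong_sq hd, projAlong, inner_sub_right, inner_smul_right, real_inner_self_eq_norm_sq]
  ring

theorem inner_projAlong_self {d : E3} (hd : ‖d‖ = 1) (e : E3) : ⟪projAlong d e, d⟫ = 0 := by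
  rw [projAlong, inner_sub_left, inner_smul_left, real_inner_self_eq_norm_sq, hd]
  simp

set_option maxRecDepth 4000 in
/-- Expansion of an inner product in the orthogonal frame `projAlong d e`, `cr e d`, `d`. -/
theorem norm_sq_mul_inner_cr {d : E3} (hd : ‖d‖ = 1) (e g F : E3) :
    ‖projAlong d e‖ ^ 2 * ⟪F, cr g d⟫ =
      ⟪F, projAlong d e⟫ * ⟪cr e g, d⟫ + ⟪F, cr e d⟫ * ⟪cr e d, cr g d⟫ := by
  have hd2 : d 0 ^ 2 + d 1 ^ 2 + d 2 ^ 2 = 1 := by rw [← norm_sq_eq_coords, hd, one_pow]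
  -- Inserting factors `‖d‖² = 1` in this and the next two equations makes both sides homogeneous in
  -- `d`, and the claim becomes a polynomial identity.
  have hu : ∀ i, projAlong d e i = (d 0 ^ 2 + d 1 ^ 2 + d 2 ^ 2) * e i - ⟪e, d⟫ * d i := by
    intro i
    rw [hd2]; simp [projAlong]
  have h1 : ⟪cr e d, cr g d⟫ = (d 0 ^ 2 + d 1 ^ 2 + d 2 ^ 2) * ⟪cr e d, cr g d⟫ := by
    rw [hd2, one_mul]
  have h1' : ⟪cr e g, d⟫ = (d 0 ^ 2 + d 1 ^ 2 + d 2 ^ 2) * ⟪cr e g, d⟫ := by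
    rw [hd2, one_mul]
  have h0 := hu 0
  have h2 := hu 1
  have h3 := hu 2
  rw [inner_eq_coords] at h0 h2 h3
  rw [h1, h1', norm_sq_eq_coords, inner_eq_coords F, inner_eq_coords F, inner_eq_coords F,
    inner_eq_coords _ d, inner_eq_coords (cr e d), h0, h2, h3]
  simp only [cr_apply_zero, cr_apply_one, cr_apply_two]
  ring

/-- A point close to a line through the origin with direction `g`, and whose distance to the plane
spanned by `d` and `e` is small, projects along `d` close to the origin in the direction of the
projection of `e`, unless `d` is nearly parallel to the plane spanned by `e` and `g`. -/
theorem five_mul_inner_projAlong_le {d : E3} (hd : ‖d‖ = 1) {e g r : E3} {l ρ : ℝ}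
    (hr : ‖r‖ ≤ ρ) (hw : |⟪l • g + r, cr e d⟫| ≤ ρ * ‖cr e d‖) (hD : ⟪cr e g, d⟫ ≠ 0)
    (hρ : 5 * (ρ * ‖g‖) ≤ |⟪cr e g, d⟫|) :
    5 * ⟪l • g + r, projAlong d e⟫ ≤ 2 * ‖projAlong d e‖ ^ 2 := by
  set F := l • g + r with hF
  have h := norm_sq_mul_inner_cr hd e g F
  set D := ⟪cr e g, d⟫
  set ℓ := ‖projAlong d e‖ with hℓ
  rw [← norm_projAlong hd, ← hℓ] at hw
  have hℓ0 : 0 ≤ ℓ := norm_nonneg _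
  have hρ0 : 0 ≤ ρ := (norm_nonneg r).trans hr
  have hN : ‖cr g d‖ ≤ ‖g‖ := by simpa [hd] using norm_cr_le g d
  -- The unbounded part `l • g` is orthogonal to `cr g d`, so only the error `r` counts.
  have h1 : |⟪F, cr g d⟫| ≤ ρ * ‖g‖ := by
    rw [hF, inner_add_left, inner_smul_left, inner_cr_left, mul_zero, zero_add]
    exact (abs_real_inner_le_norm _ _).trans (mul_le_mul hr hN (norm_nonneg _) hρ0)
  have h2 : |⟪cr e d, cr g d⟫| ≤ ℓ * ‖g‖ := by
    refine (abs_real_inner_le_norm _ _).trans ?_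
    rw [← norm_projAlong hd]
    exact mul_le_mul_of_nonneg_left hN hℓ0
  have h3 : |⟪F, cr e d⟫ * ⟪cr e d, cr g d⟫| ≤ ρ * ℓ * (ℓ * ‖g‖) := by
    rw [abs_mul]
    exact mul_le_mul hw h2 (abs_nonneg _) (by positivity)
  -- Both terms of the frame expansion are at most `ℓ² ρ ‖g‖`; dividing by `|D| ≥ 5 ρ ‖g‖` will
  -- leave `2/5` of `ℓ²`.
  have h4 : |⟪F, projAlong d e⟫ * D| ≤ 2 * ℓ ^ 2 * (ρ * ‖g‖) := by
    have e1 : ⟪F, projAlong d e⟫ * D = ℓ ^ 2 * ⟪F, cr g d⟫ - ⟪F, cr e d⟫ * ⟪cr e d, cr g d⟫ := by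
      linarith
    rw [e1]
    refine (abs_sub _ _).trans ?_
    rw [abs_mul, abs_of_nonneg (sq_nonneg ℓ)]
    have := mul_le_mul_of_nonneg_left h1 (sq_nonneg ℓ)
    linarith
  rw [abs_mul] at h4
  have hD' : 0 < |D| := abs_pos.2 hD
  have h5 : |⟪F, projAlong d e⟫| * |D| * 5 ≤ 2 * ℓ ^ 2 * |D| := by
    have := mul_le_mul_of_nonneg_left hρ (show 0 ≤ 2 * ℓ ^ 2 by positivity)
    linarith
  have h6 : 5 * |⟪F, projAlong d e⟫| ≤ 2 * ℓ ^ 2 := by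
    by_contra hc
    have := mul_lt_mul_of_pos_right (not_le.1 hc) hD'
    linarith
  linarith [le_abs_self ⟪F, projAlong d e⟫]

/-- Height times base is twice the area; the height is bounded through the foot of the
perpendicular, which has parameter `t` on the line. -/
theorem infDist_line_mul_le (v p q : E3) :
    Metric.infDist v (affineSpan ℝ ({p, q} : Set E3) : Set E3) * ‖q - p‖ ≤
      ‖cr (v - p) (q - p)‖ := by
  set g := q - p with hg
  rcases eq_or_ne g 0 with h0 | h0
  · simp [h0]
  have hg0 : 0 < ‖g‖ := norm_pos_iff.2 h0
  set t := ⟪v - p, g⟫ / ‖g‖ ^ 2 with ht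
  have hmem : AffineMap.lineMap p q t ∈ affineSpan ℝ ({p, q} : Set E3) :=
    AffineMap.lineMap_mem_affineSpan_pair t p q
  have h1 : Metric.infDist v (affineSpan ℝ ({p, q} : Set E3) : Set E3) ≤ ‖(v - p) - t • g‖ := by
    refine (Metric.infDist_le_dist_of_mem hmem).trans_eq ?_
    rw [dist_eq_norm, AffineMap.lineMap_apply, vsub_eq_sub, vadd_eq_add]
    congr 1
    abel
  refine (mul_le_mul_of_nonneg_right h1 hg0.le).trans ?_
  apply le_of_sq_le_sq _ (by positivity)
  rw [mul_pow, norm_sub_sq_real, inner_smul_right, norm_smul, norm_cr_sq, mul_pow,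
    Real.norm_eq_abs, sq_abs]
  apply le_of_eq
  rw [ht]
  field_simp
  ring

theorem faceNormal_swap (a b c : E3) : faceNormal b a c = -faceNormal a b c := by
  simp only [faceNormal_eq_cr]
  apply E3_ext <;> simp <;> ring

theorem inner_edge_faceNormal (a b c : E3) : ⟪b - a, faceNormal a b c⟫ = 0 :=
  inner_cr_left _ _

/-! ### Splitting a wedge into two zones and a wide part. -/

/-- The sine of the angle between `e` and the unit vector `d`. -/
def sinAngle (e d : E3) : ℝ := ‖projAlong d e‖ / ‖e‖

theorem sinAngle_nonneg (e d : E3) : 0 ≤ sinAngle e d := by unfold sinAngle; positivity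

/-- The directions that separate front from back between the faces with normals `n`, `n'`, and from
which both faces are seen from an angle of sine at least `τ`. -/
def wideWedge (n n' : E3) (τ : ℝ) : Set E3 :=
  {d | d ∈ doubleWedge n n' ∧ τ * ‖n‖ ≤ |⟪n, d⟫| ∧ τ * ‖n'‖ ≤ |⟪n', d⟫|}

theorem measurableSet_wideWedge (n n' : E3) (τ : ℝ) : MeasurableSet (wideWedge n n' τ) :=
  (measurableSet_doubleWedge n n').inter
    ((show MeasurableSet {d : E3 | τ * ‖n‖ ≤ |⟪n, d⟫|} from
      measurableSet_le (by fun_prop) (by fun_prop)).inter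
    (show MeasurableSet {d : E3 | τ * ‖n'‖ ≤ |⟪n', d⟫|} from
      measurableSet_le (by fun_prop) (by fun_prop)))

@[fun_prop]
theorem measurable_sinAngle (e : E3) : Measurable fun d : Viewpoint ↦ sinAngle e d := by
  unfold sinAngle projAlong
  fun_prop

/-- Each of the two zones of half-width `5δ` costs `3/2 * (2/3 * 5δ) = 5δ`; outside them the
direction belongs to the wide wedge. -/
theorem uniformViewpoint_doubleWedge_le (e n n' : E3) (he : e ≠ 0) (hn : ⟪e, n⟫ = 0)
    (hn' : ⟪e, n'⟫ = 0) (δ : ℝ) (hδ : 0 < δ) :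
    ∫⁻ d : Viewpoint, (doubleWedge n n').indicator 1 (d : E3) ∂uniformViewpoint ≤
      ENNReal.ofReal (10 * δ) + ENNReal.ofReal (3 / 2) *
        ∫⁻ d : Viewpoint, ENNReal.ofReal (sinAngle e d) *
          (wideWedge n n' (5 * δ)).indicator 1 (d : E3) ∂uniformViewpoint := by
  -- If `10δ ≥ 1` the bound is trivial; otherwise `5δ ≤ 1/2`, as the zone estimate requires.
  rcases le_or_gt (1 / 10) δ with h10 | h10
  · refine le_trans ?_ le_self_add
    calc ∫⁻ d : Viewpoint, (doubleWedge n n').indicator 1 (d : E3) ∂uniformViewpoint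
        ≤ ∫⁻ d : Viewpoint, 1 ∂uniformViewpoint :=
          lintegral_mono fun d ↦ indicator_le_self' (by simp) _
      _ = 1 := by simp
      _ ≤ _ := by
        rw [← ENNReal.ofReal_one]
        exact ENNReal.ofReal_le_ofReal (by linarith)
  by_cases hz : n = 0 ∨ n' = 0
  · have : doubleWedge n n' = ∅ := by
      ext d
      rcases hz with rfl | rfl <;> simp [doubleWedge]
    simp [this]
  rw [not_or] at hz
  obtain ⟨hz, hz'⟩ := hz
  have he0 : 0 < ‖e‖ := norm_pos_iff.2 he
  set ε : E3 := ‖e‖⁻¹ • e with hε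
  have hε1 : ‖ε‖ = 1 := by rw [hε, norm_smul]; simp [he0.ne']
  have hεn : ⟪ε, n⟫ = 0 := by rw [hε, real_inner_smul_left, hn, mul_zero]
  have hεn' : ⟪ε, n'⟫ = 0 := by rw [hε, real_inner_smul_left, hn', mul_zero]
  rw [uniformViewpoint_doubleWedge ε n n' hε1 hεn hεn']
  have hs : ∀ d : Viewpoint, 1 - ⟪ε, (d : E3)⟫ ^ 2 = sinAngle e d ^ 2 := by
    intro d
    have hd : ‖(d : E3)‖ = 1 := by simp
    rw [sinAngle, div_pow, norm_projAlong_sq hd, hε, real_inner_smul_left]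
    field_simp
  have hs1 : ∀ d : Viewpoint, sinAngle e d ≤ 1 := by
    intro d
    have hd : ‖(d : E3)‖ = 1 := by simp
    rw [sinAngle, div_le_one he0]
    exact norm_projAlong_le hd e
  set Z : E3 → Set E3 := fun m ↦ {x : E3 | |⟪m, x⟫| < (5 * δ) * ‖m‖} with hZ
  have hmZ : ∀ m, MeasurableSet (Z m) := fun m ↦ measurableSet_lt (by fun_prop) (by fun_prop)
  have hiZ : ∀ m, Measurable ((Z m).indicator (1 : E3 → ℝ≥0∞)) := fun m ↦
    measurable_one.indicator (hmZ m)
  have hiG : Measurable ((wideWedge n n' (5 * δ)).indicator (1 : E3 → ℝ≥0∞)) :=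
    measurable_one.indicator (measurableSet_wideWedge n n' _)
  have hpt : ∀ d : Viewpoint, ENNReal.ofReal (1 - ⟪ε, (d : E3)⟫ ^ 2) *
      (doubleWedge n n').indicator 1 (d : E3) ≤
      (ENNReal.ofReal (1 - ⟪ε, (d : E3)⟫ ^ 2) * (Z n).indicator 1 (d : E3) +
      ENNReal.ofReal (1 - ⟪ε, (d : E3)⟫ ^ 2) * (Z n').indicator 1 (d : E3)) +
      ENNReal.ofReal (sinAngle e d) * (wideWedge n n' (5 * δ)).indicator 1 (d : E3) := by
    intro d
    by_cases hW : (d : E3) ∈ doubleWedge n n'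
    swap
    · simp [hW]
    by_cases h1 : (d : E3) ∈ Z n
    · refine le_trans ?_ (le_trans le_self_add le_self_add)
      simp [hW, h1]
    by_cases h2 : (d : E3) ∈ Z n'
    · refine le_trans ?_ (le_trans le_add_self le_self_add)
      simp [hW, h2]
    refine le_trans ?_ le_add_self
    have h3 : (d : E3) ∈ wideWedge n n' (5 * δ) := ⟨hW, not_lt.1 h1, not_lt.1 h2⟩
    simp only [hW, h3, indicator_of_mem, Pi.one_apply, mul_one, hs]
    apply ENNReal.ofReal_le_ofReal
    -- `sin² ≤ sin`: the first power is what a projected length controls.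
    nlinarith [hs1 d, sinAngle_nonneg e d]
  have hz1 := uniformViewpoint_zone_moment_le n ε hz hε1 hεn (5 * δ) (by positivity) (by linarith)
  have hz2 := uniformViewpoint_zone_moment_le n' ε hz' hε1 hεn' (5 * δ) (by positivity)
    (by linarith)
  have hint := lintegral_mono (μ := uniformViewpoint) hpt
  rw [lintegral_add_right _ (by fun_prop), lintegral_add_right _ (by fun_prop)] at hint
  have hsum : ENNReal.ofReal (3 / 2) * (ENNReal.ofReal (2 / 3 * (5 * δ)) +
      ENNReal.ofReal (2 / 3 * (5 * δ))) = ENNReal.ofReal (10 * δ) := by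
    rw [← ENNReal.ofReal_add (by positivity) (by positivity), ← ENNReal.ofReal_mul (by norm_num)]
    congr 1; ring
  rw [← hsum, ← mul_add]
  gcongr
  exact hint.trans (add_le_add (add_le_add hz1 hz2) le_rfl)

/-! ### Silhouette points on rays with an empty half-plane beside them. -/

theorem add_smul_mem_openSegment (q d : E3) {α β s : ℝ} (h1 : β < s) (h2 : s < α) :
    q + s • d ∈ openSegment ℝ (q + α • d) (q + β • d) := by
  have h : 0 < α - β := by linarith
  refine ⟨(s - β) / (α - β), (α - s) / (α - β), div_pos (by linarith) h, div_pos (by linarith) h,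
    by field_simp; ring, ?_⟩
  have : ((s - β) / (α - β)) • (q + α • d) + ((α - s) / (α - β)) • (q + β • d) =
      ((s - β) / (α - β) + (α - s) / (α - β)) • q +
        ((s - β) / (α - β) * α + (α - s) / (α - β) * β) • d := by module
  rw [this, show (s - β) / (α - β) + (α - s) / (α - β) = 1 by field_simp; ring,
    show (s - β) / (α - β) * α + (α - s) / (α - β) * β = s by field_simp; ring, one_smul]

theorem exists_of_mem_openSegment (q d : E3) {α β : ℝ} (h : β < α) {x : E3}
    (hx : x ∈ openSegment ℝ (q + α • d) (q + β • d)) :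
    ∃ s, β < s ∧ s < α ∧ x = q + s • d := by
  obtain ⟨u, v, hu, hv, huv, rfl⟩ := hx
  obtain rfl : u = 1 - v := by linarith
  refine ⟨(1 - v) * α + v * β, ?_, ?_, ?_⟩
  · nlinarith
  · nlinarith
  · have : (1 - v) • (q + α • d) + v • (q + β • d) = q + ((1 - v) * α + v * β) • d := by module
    rw [this]

theorem viewRay_eq {d p q : E3} (h : p ∈ viewRay d q) : viewRay d p = viewRay d q := by
  obtain ⟨s, rfl⟩ := h
  ext x
  constructor
  · rintro ⟨t, rfl⟩
    exact ⟨s + t, by module⟩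
  · rintro ⟨t, rfl⟩
    exact ⟨t - s, by module⟩

theorem isClosed_viewRay (d q : E3) : IsClosed (viewRay d q) := by
  have : viewRay d q = (fun x ↦ q + x) '' (Submodule.span ℝ {d} : Set E3) := by
    ext x
    simp only [viewRay, mem_ofPred_eq, mem_image, SetLike.mem_coe, Submodule.mem_span_singleton]
    constructor
    · rintro ⟨s, rfl⟩
      exact ⟨s • d, ⟨s, rfl⟩, rfl⟩
    · rintro ⟨_, ⟨s, rfl⟩, rfl⟩
      exact ⟨s, rfl⟩
  rw [this]
  exact (Homeomorph.addLeft q).isClosedMap _ (Submodule.closed_of_finiteDimensional _)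

theorem isCompact_connectedComponentIn {F : Set E3} (hF : IsCompact F) (x : E3) :
    IsCompact (connectedComponentIn F x) := by
  by_cases hx : x ∈ F
  · refine hF.of_isClosed_subset ?_ (connectedComponentIn_subset F x)
    have h1 : IsPreconnected (closure (connectedComponentIn F x)) :=
      isPreconnected_connectedComponentIn.closure
    have h2 : closure (connectedComponentIn F x) ⊆ F :=
      closure_minimal (connectedComponentIn_subset F x) hF.isClosed
    exact isClosed_of_closure_subset
      (h1.subset_connectedComponentIn (subset_closure (mem_connectedComponentIn hx)) h2)
  · rw [connectedComponentIn_eq_empty hx]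
    exact isCompact_empty

/-- If `S` is the union of compact sets `M` and `Q`, and if the half-plane bounded by the ray through
`q` on the side of `w` does not meet `M`, then this ray carries a silhouette point of `S`, provided
that `M` and `Q` do not meet on it. -/
theorem exists_mem_silhouette {M Q : Set E3} (hM : IsCompact M) (hQ : IsCompact Q) {d w q : E3}
    (hd : ‖d‖ = 1) (hq : q ∈ M) (hMQ : ∀ x ∈ viewRay d q, x ∈ M → x ∉ Q)
    (hmax : ∀ s t : ℝ, 0 < t → q + s • d + t • w ∉ M) :
    ∃ p ∈ silhouette (M ∪ Q) d, p ∈ M ∧ p ∉ Q ∧ p ∈ viewRay d q := by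
  set S := M ∪ Q with hS
  set R := viewRay d q with hR
  have hqR : q ∈ R := ⟨0, by simp⟩
  have hqRS : q ∈ R ∩ S := ⟨hqR, Or.inl hq⟩
  have hRS : IsCompact (R ∩ S) := (hM.union hQ).inter_left (isClosed_viewRay d q)
  set J := connectedComponentIn (R ∩ S) q with hJ
  have hJc : IsCompact J := isCompact_connectedComponentIn hRS q
  have hJp : IsPreconnected J := isPreconnected_connectedComponentIn
  have hJsub : J ⊆ R ∩ S := connectedComponentIn_subset _ _
  have hqJ : q ∈ J := mem_connectedComponentIn hqRS
  -- On this ray `M` and `Q` are disjoint closed sets, so a connected component of the section stays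
  -- in one of them.
  have hJM : J ⊆ M := by
    have h := isPreconnected_iff_subset_of_disjoint_closed.1 hJp M Q hM.isClosed hQ.isClosed
      (fun x hx ↦ (hJsub hx).2) (by
        ext x
        simp only [mem_inter_iff, mem_empty_iff_false, iff_false]
        rintro ⟨h1, h2, h3⟩
        exact hMQ x (hJsub h1).1 h2 h3)
    rcases h with h | h
    · exact h
    · exact absurd (h hqJ) (hMQ q hqR hq)
  have hJQ : Disjoint J Q := disjoint_left.2 fun x hx ↦ hMQ x (hJsub hx).1 (hJM hx)
  have hdd : ⟪d, d⟫ = 1 := by rw [real_inner_self_eq_norm_sq, hd, one_pow]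
  have hz : ∀ s : ℝ, ⟪q + s • d, d⟫ = ⟪q, d⟫ + s := by
    intro s
    rw [inner_add_left, real_inner_smul_left, hdd, mul_one]
  obtain ⟨p, hpJ, hp⟩ := hJc.exists_isMaxOn ⟨q, hqJ⟩
    (f := fun x ↦ ⟪x, d⟫) (by fun_prop)
  obtain ⟨p', hpJ', hp'⟩ := hJc.exists_isMinOn ⟨q, hqJ⟩
    (f := fun x ↦ ⟪x, d⟫) (by fun_prop)
  obtain ⟨α, hα⟩ := (hJsub hpJ).1
  obtain ⟨β, hβ⟩ := (hJsub hpJ').1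
  have hpar : ∀ x ∈ J, ∃ s, β ≤ s ∧ s ≤ α ∧ x = q + s • d := by
    intro x hx
    obtain ⟨s, rfl⟩ := (hJsub hx).1
    have h1 : ⟪q + s • d, d⟫ ≤ ⟪p, d⟫ := hp hx
    have h2 : ⟪p', d⟫ ≤ ⟪q + s • d, d⟫ := hp' hx
    rw [hα, hz, hz] at h1
    rw [hβ, hz, hz] at h2
    exact ⟨s, by linarith, by linarith, rfl⟩
  have hmem : ∀ s, β ≤ s → s ≤ α → q + s • d ∈ J := by
    intro s h1 h2
    have himg : IsPreconnected ((fun x : E3 ↦ ⟪x, d⟫) '' J) :=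
      hJp.image _ (by fun_prop)
    have hs : ⟪q, d⟫ + s ∈ (fun x : E3 ↦ ⟪x, d⟫) '' J := by
      apply himg.Icc_subset (mem_image_of_mem _ hpJ') (mem_image_of_mem _ hpJ)
      simp only [hα, hβ, hz]
      exact ⟨by linarith, by linarith⟩
    obtain ⟨x, hx, hxs⟩ := hs
    obtain ⟨s', -, -, rfl⟩ := hpar x hx
    simp only [hz] at hxs
    rwa [← add_left_cancel hxs]
  have hβα : β ≤ α := by
    obtain ⟨s, h1, h2, -⟩ := hpar q hqJ
    exact h1.trans h2
  obtain ⟨η, hη, hdisj⟩ := hJQ.exists_thickenings hJc hQ.isClosed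
  set t₀ := η / (2 * (‖w‖ + 1)) with ht₀
  have hw1 : 0 < ‖w‖ + 1 := by positivity
  have ht₀pos : 0 < t₀ := by positivity
  -- A thin strip beside `J`, slightly longer than `J`. It is connected, misses `M` because it lies
  -- in the empty half-plane, and misses `Q` because it is within `η` of `J`. So it lies in one
  -- component of the complement, and the closure of that component contains an open segment of the
  -- ray around `J`.
  set N : Set E3 := (fun x : E3 × ℝ × ℝ ↦ x.1 + x.2.1 • d + x.2.2 • w) ''
    (J ×ˢ (Ioo (-(η / 2)) (η / 2) ×ˢ Ioo 0 t₀)) with hN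
  have hNp : IsPreconnected N :=
    (hJp.prod (isPreconnected_Ioo.prod isPreconnected_Ioo)).image _ (by fun_prop)
  have hNS : N ⊆ Sᶜ := by
    rintro _ ⟨⟨j, r, t⟩, ⟨hj, hr, ht⟩, rfl⟩ hx
    simp only at hj hr ht hx
    rcases hx with hx | hx
    · obtain ⟨s, -, -, rfl⟩ := hpar j hj
      refine hmax (s + r) t ht.1 ?_
      rwa [add_smul, ← add_assoc]
    · refine disjoint_left.1 hdisj (Metric.mem_thickening_iff.2 ⟨j, hj, ?_⟩)
        (Metric.self_subset_thickening hη Q hx)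
      rw [dist_eq_norm, show j + r • d + t • w - j = r • d + t • w by abel]
      have h1 : ‖r • d‖ < η / 2 := by
        rw [norm_smul, hd, mul_one, Real.norm_eq_abs]
        exact abs_lt.2 hr
      have h2 : ‖t • w‖ ≤ η / 2 := by
        rw [norm_smul, Real.norm_of_nonneg ht.1.le]
        have : t * (‖w‖ + 1) ≤ η / 2 := by
          have h3 := ht.2.le
          rw [ht₀, le_div_iff₀ (by positivity)] at h3
          linarith
        nlinarith [ht.1, norm_nonneg w]
      linarith [norm_add_le (r • d) (t • w)]
  set x₀ := p + (0 : ℝ) • d + (t₀ / 2) • w with hx₀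
  have hx₀N : x₀ ∈ N := ⟨(p, 0, t₀ / 2), ⟨hpJ, ⟨by simp [hη], by simp [hη]⟩,
    ⟨by simp [ht₀pos], by simp [ht₀pos]⟩⟩, rfl⟩
  have hNC : N ⊆ connectedComponentIn Sᶜ x₀ := hNp.subset_connectedComponentIn hx₀N hNS
  have hcl : ∀ s, β - η / 2 < s → s < α + η / 2 → q + s • d ∈ closure N := by
    intro s h1 h2
    -- `c` is `s` clamped to `[β, α]`.
    obtain ⟨c, hc1, hc2, hc3, hc4⟩ : ∃ c, β ≤ c ∧ c ≤ α ∧ -(η / 2) < s - c ∧ s - c < η / 2 := by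
      rcases le_or_gt s β with h | h
      · exact ⟨β, le_rfl, hβα, by linarith, by linarith⟩
      rcases le_or_gt α s with h' | h'
      · exact ⟨α, hβα, le_rfl, by linarith, by linarith⟩
      · exact ⟨s, h.le, h'.le, by linarith, by linarith⟩
    have h0 : (0 : ℝ) ∈ closure (Ioo 0 t₀) := by
      rw [closure_Ioo ht₀pos.ne]
      exact ⟨le_rfl, ht₀pos.le⟩
    have := map_mem_closure (f := fun t : ℝ ↦ q + s • d + t • w) (t := N) (by fun_prop) h0 (by
      intro t ht
      refine ⟨(q + c • d, s - c, t), ⟨hmem c hc1 hc2, ⟨hc3, hc4⟩, ht⟩, ?_⟩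
      module)
    simpa using this
  refine ⟨p, ⟨(hJsub hpJ).2, ?_, ?_⟩, hJM hpJ, disjoint_left.1 hJQ hpJ, (hJsub hpJ).1⟩
  · rw [viewRay_eq (hJsub hpJ).1, ← connectedComponentIn_eq hpJ]
    exact fun x hx ↦ hp hx
  · rw [viewRay_eq (hJsub hpJ).1, ← connectedComponentIn_eq hpJ]
    refine ⟨q + (α + η / 2) • d, ⟨_, rfl⟩, q + (β - η / 2) • d, ⟨_, rfl⟩, ?_, ?_,
      closure (connectedComponentIn Sᶜ x₀), ⟨x₀, hNS hx₀N, rfl⟩, ?_⟩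
    · intro h
      have := congrArg (fun x : E3 ↦ ⟪x, d⟫) h
      simp only [hz] at this
      linarith
    · intro x hx
      obtain ⟨s, h1, h2, rfl⟩ := hpar x hx
      exact add_smul_mem_openSegment q d (by linarith) (by linarith)
    · intro x hx
      obtain ⟨s, h1, h2, rfl⟩ := exists_of_mem_openSegment q d (by linarith) hx
      exact closure_mono hNC (hcl s h1 h2)

/-! ### Silhouette arcs from extreme points of a projection. -/

theorem continuous_projAlong (d : E3) : Continuous (projAlong d) := by
  unfold projAlong
  fun_prop

theorem inner_projAlong_left {d : E3} (x : E3) {z : E3} (hz : ⟪d, z⟫ = 0) :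
    ⟪projAlong d x, z⟫ = ⟪x, z⟫ := by
  rw [projAlong, inner_sub_left, real_inner_smul_left, hz, mul_zero, sub_zero]

theorem inner_self_projAlong_left {d : E3} (hd : ‖d‖ = 1) (e : E3) : ⟪d, projAlong d e⟫ = 0 := by
  rw [real_inner_comm, inner_projAlong_self hd]

theorem mem_viewRay_iff {d : E3} (hd : ‖d‖ = 1) (p q : E3) :
    p ∈ viewRay d q ↔ projAlong d p = projAlong d q := by
  constructor
  · rintro ⟨s, rfl⟩
    simp only [projAlong, inner_add_left, real_inner_smul_left, real_inner_self_eq_norm_sq, hd]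
    module
  · intro h
    refine ⟨⟪p, d⟫ - ⟪q, d⟫, ?_⟩
    simp only [projAlong] at h
    rw [sub_smul, eq_comm, ← sub_eq_zero]
    rw [← sub_eq_zero] at h
    rw [← neg_eq_zero, ← h]
    abel

theorem cr_cr_self {d : E3} (hd : ‖d‖ = 1) {z : E3} (hz : ⟪z, d⟫ = 0) : cr (cr d z) d = z := by
  have hd2 : d 0 ^ 2 + d 1 ^ 2 + d 2 ^ 2 = 1 := by rw [← norm_sq_eq_coords, hd, one_pow]
  rw [inner_eq_coords] at hz
  apply E3_ext <;> simp only [cr_apply_zero, cr_apply_one, cr_apply_two]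
  · linear_combination (z 0) * hd2 - d 0 * hz
  · linear_combination (z 1) * hd2 - d 1 * hz
  · linear_combination (z 2) * hd2 - d 2 * hz

/-- In the plane orthogonal to `d`, the line orthogonal to the projection of `e` is spanned by `cr e
d`. This is the frame expansion for `g = cr d z`, since then `cr g d = z`. -/
theorem norm_sq_smul_eq {d : E3} (hd : ‖d‖ = 1) (e : E3) {z : E3} (hz : ⟪z, d⟫ = 0)
    (hu : ⟪z, projAlong d e⟫ = 0) : ‖projAlong d e‖ ^ 2 • z = ⟪z, cr e d⟫ • cr e d := by
  apply ext_inner_left ℝ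
  intro F
  have h := norm_sq_mul_inner_cr hd e (cr d z) F
  rw [cr_cr_self hd hz, ← inner_cr_rotate, cr_cr_self hd hz] at h
  have h1 : ⟪e, z⟫ = 0 := by
    have : ⟪z, projAlong d e⟫ = ⟪z, e⟫ := by
      rw [projAlong, inner_sub_right, inner_smul_right, hz, mul_zero, sub_zero]
    rw [real_inner_comm, ← this, hu]
  rw [h1, mul_zero, zero_add] at h
  rw [inner_smul_right, inner_smul_right, h, real_inner_comm z]
  ring

/-- The complement is a countable union of compact sets, one for each range `[1 / (k + 1), k + 1]`
of `t`. -/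
theorem measurableSet_forall_add_smul_notMem {P : Set E3} (hP : IsCompact P) (w : E3) :
    MeasurableSet {v : E3 | ∀ t : ℝ, 0 < t → v + t • w ∉ P} := by
  have h : {v : E3 | ∀ t : ℝ, 0 < t → v + t • w ∉ P} =
      (⋃ k : ℕ, (fun x : E3 × ℝ ↦ x.1 - x.2 • w) '' (P ×ˢ Icc (1 / ((k : ℝ) + 1)) (k + 1)))ᶜ := by
    ext v
    simp only [mem_ofPred_eq, mem_compl_iff, mem_iUnion, mem_image, mem_prod, Prod.exists,
      not_exists, not_and, and_imp]
    constructor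
    · rintro h k p t hp ht rfl
      have hk : (0 : ℝ) < 1 / ((k : ℝ) + 1) := by positivity
      apply h t (hk.trans_le ht.1)
      simpa using hp
    · intro h t ht hv
      obtain ⟨k₁, hk₁⟩ := exists_nat_one_div_lt ht
      obtain ⟨k₂, hk₂⟩ := exists_nat_ge t
      refine h (max k₁ k₂) (v + t • w) t hv ⟨?_, ?_⟩ (by simp)
      · refine le_trans ?_ hk₁.le
        apply one_div_le_one_div_of_le (by positivity)
        push_cast
        linarith [le_max_left (k₁ : ℝ) k₂]
      · push_cast
        linarith [le_max_right (k₁ : ℝ) k₂]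
  rw [h]
  refine (MeasurableSet.iUnion fun k ↦ ?_).compl
  exact ((hP.prod isCompact_Icc).image (by fun_prop)).isClosed.measurableSet

/-- Let `M` and `Q` be compact sets such that, over the middle fifth of the projection of a segment
`e` based at `a`, the set `M` is nonempty and no point of `M ∩ Q` is extreme in `M` in the direction
orthogonal to this projection.  Then the silhouette of `M ∪ Q` has a part in `M \ Q` that projects
onto a set at least as long as this middle fifth. -/
theorem exists_silhouette_arc {M Q : Set E3} (hM : IsCompact M) (hQ : IsCompact Q) {d e a : E3}
    (hd : ‖d‖ = 1) (he : 0 < ‖projAlong d e‖)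
    (hfill : ∀ τ, 2 * ‖projAlong d e‖ ^ 2 < 5 * τ → 5 * τ < 3 * ‖projAlong d e‖ ^ 2 →
      ∃ q ∈ M, ⟪q - a, projAlong d e⟫ = τ)
    (hMQ : ∀ x ∈ M, x ∈ Q → 2 * ‖projAlong d e‖ ^ 2 < 5 * ⟪x - a, projAlong d e⟫ →
      5 * ⟪x - a, projAlong d e⟫ < 3 * ‖projAlong d e‖ ^ 2 →
      ∃ q ∈ M, ⟪q - a, projAlong d e⟫ = ⟪x - a, projAlong d e⟫ ∧
        ⟪x - a, cr e d⟫ < ⟪q - a, cr e d⟫) :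
    ∃ A : Set E3, MeasurableSet A ∧ ENNReal.ofReal (‖projAlong d e‖ / 5) ≤ μH[1] A ∧
      ∀ v ∈ A, ∃ p ∈ silhouette (M ∪ Q) d, p ∈ M ∧ p ∉ Q ∧ projAlong d p = v := by
  set u := projAlong d e with hu
  set w := cr e d with hw
  set ℓ := ‖u‖ with hℓ
  have hdu : ⟪d, u⟫ = 0 := inner_self_projAlong_left hd e
  have hdw : ⟪d, w⟫ = 0 := inner_cr_right e d
  have huw : ⟪w, u⟫ = 0 := by
    have hwd : ⟪w, d⟫ = 0 := by rw [real_inner_comm, hdw]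
    have hwe : ⟪w, e⟫ = 0 := by rw [real_inner_comm, hw, inner_cr_left]
    rw [hu, projAlong, inner_sub_right, inner_smul_right, hwe, hwd, mul_zero, sub_zero]
  have hww : ⟪w, w⟫ = ℓ ^ 2 := by
    rw [real_inner_self_eq_norm_sq, hw, ← norm_projAlong hd]
  have hpu : ∀ x y : E3, ⟪projAlong d x - y, u⟫ = ⟪x - y, u⟫ := fun x y ↦ by
    rw [inner_sub_left, inner_projAlong_left x hdu, inner_sub_left]
  have hpw : ∀ x y : E3, ⟪projAlong d x - y, w⟫ = ⟪x - y, w⟫ := fun x y ↦ by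
    rw [inner_sub_left, inner_projAlong_left x hdw, inner_sub_left]
  set P := projAlong d '' M with hP
  have hPc : IsCompact P := hM.image (continuous_projAlong d)
  -- The topmost points, in the direction `w`, of the projection of `M` over the middle fifth.
  set A : Set E3 := (P ∩ {v : E3 | 2 * ℓ ^ 2 < 5 * ⟪v - a, u⟫ ∧ 5 * ⟪v - a, u⟫ < 3 * ℓ ^ 2}) ∩
    {v : E3 | ∀ t : ℝ, 0 < t → v + t • w ∉ P} with hA
  refine ⟨A, ?_, ?_, ?_⟩
  · refine (hPc.isClosed.measurableSet.inter ?_).inter (measurableSet_forall_add_smul_notMem hPc w)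
    exact (show MeasurableSet {v : E3 | 2 * ℓ ^ 2 < 5 * ⟪v - a, u⟫} from
      measurableSet_lt (by fun_prop) (by fun_prop)).inter
      (show MeasurableSet {v : E3 | 5 * ⟪v - a, u⟫ < 3 * ℓ ^ 2} from
      measurableSet_lt (by fun_prop) (by fun_prop))
  -- The normalized coordinate along `u` is `1`-Lipschitz and maps `A` onto an interval of length `ℓ
  -- / 5` or more, which bounds the Hausdorff measure of `A` from below.
  · have hlip : LipschitzWith 1 (fun v : E3 ↦ ⟪v - a, u⟫ / ℓ) := by
      apply LipschitzWith.of_dist_le_mul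
      intro x y
      rw [Real.dist_eq, ← sub_div, ← inner_sub_left, sub_sub_sub_cancel_right, abs_div,
        abs_of_pos he, NNReal.coe_one, one_mul, div_le_iff₀ he, dist_eq_norm]
      exact abs_real_inner_le_norm _ _
    have himg : Ioo (2 / 5 * ℓ) (3 / 5 * ℓ) ⊆ (fun v : E3 ↦ ⟪v - a, u⟫ / ℓ) '' A := by
      intro τ hτ
      have h1 : 2 * ℓ ^ 2 < 5 * (τ * ℓ) := by nlinarith [hτ.1]
      have h2 : 5 * (τ * ℓ) < 3 * ℓ ^ 2 := by nlinarith [hτ.2]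
      obtain ⟨q₁, hq₁, hq₁τ⟩ := hfill (τ * ℓ) h1 h2
      have hc : IsCompact (M ∩ {q : E3 | ⟪q - a, u⟫ = τ * ℓ}) :=
        hM.inter_right (isClosed_eq (by fun_prop) (by fun_prop))
      obtain ⟨q, ⟨hqM, hqτ⟩, hq⟩ := hc.exists_isMaxOn ⟨q₁, hq₁, hq₁τ⟩
        (f := fun x ↦ ⟪x - a, w⟫) (by fun_prop)
      have hqτ' : ⟪q - a, u⟫ = τ * ℓ := hqτ
      refine ⟨projAlong d q, ⟨⟨mem_image_of_mem _ hqM, ?_⟩, ?_⟩, ?_⟩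
      · simp only [mem_ofPred_eq, hpu, hqτ']
        exact ⟨h1, h2⟩
      · rintro t ht ⟨q', hq'M, hq'⟩
        have e1 : ⟪q' - a, u⟫ = τ * ℓ := by
          rw [← hpu, hq', add_sub_right_comm, inner_add_left, hpu, hqτ', real_inner_smul_left, huw,
            mul_zero, add_zero]
        have e2 : ⟪q' - a, w⟫ = ⟪q - a, w⟫ + t * ℓ ^ 2 := by
          rw [← hpw, hq', add_sub_right_comm, inner_add_left, hpw, real_inner_smul_left, hww]
        have h3 : ⟪q' - a, w⟫ ≤ ⟪q - a, w⟫ := hq ⟨hq'M, e1⟩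
        have : 0 < t * ℓ ^ 2 := by positivity
        linarith
      · simp only [hpu, hqτ']
        field_simp
    calc ENNReal.ofReal (ℓ / 5) = volume (Ioo (2 / 5 * ℓ) (3 / 5 * ℓ)) := by
          rw [Real.volume_Ioo]
          congr 1; ring
      _ ≤ volume ((fun v : E3 ↦ ⟪v - a, u⟫ / ℓ) '' A) := measure_mono himg
      _ = μH[1] ((fun v : E3 ↦ ⟪v - a, u⟫ / ℓ) '' A) := by rw [hausdorffMeasure_real]
      _ ≤ _ := by simpa using hlip.hausdorffMeasure_image_le zero_le_one A
  · rintro v ⟨⟨⟨q, hqM, rfl⟩, hv1, hv2⟩, hv⟩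
    rw [hpu] at hv1 hv2
    have h1 : ∀ x ∈ viewRay d q, x ∈ M → x ∉ Q := by
      intro x hx hxM hxQ
      rw [mem_viewRay_iff hd] at hx
      have hxu : ⟪x - a, u⟫ = ⟪q - a, u⟫ := by rw [← hpu, hx, hpu]
      have hxw : ⟪x - a, w⟫ = ⟪q - a, w⟫ := by rw [← hpw, hx, hpw]
      -- `q'` projects strictly above `v` on the same line of direction `w`, which contradicts that
      -- `v` is topmost.
      obtain ⟨q', hq'M, h1, h2⟩ := hMQ x hxM hxQ (by rwa [hxu]) (by rwa [hxu])
      set z := projAlong d q' - projAlong d q with hz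
      have hzd : ⟪z, d⟫ = 0 := by
        rw [hz, inner_sub_left, inner_projAlong_self hd, inner_projAlong_self hd, sub_zero]
      have hzu : ⟪z, u⟫ = 0 := by
        rw [hz, hpu, ← sub_sub_sub_cancel_right q' _ a, inner_sub_left, h1, hpu, hxu, sub_self]
      have hzw : 0 < ⟪z, w⟫ := by
        rw [hz, hpw, ← sub_sub_sub_cancel_right q' _ a, inner_sub_left, hpw, ← hxw]
        linarith
      have hzeq := norm_sq_smul_eq hd e hzd hzu
      refine hv (⟪z, w⟫ / ℓ ^ 2) (by positivity) ⟨q', hq'M, ?_⟩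
      have : z = (⟪z, w⟫ / ℓ ^ 2) • w := by
        rw [div_eq_inv_mul, mul_smul, ← hw] at *
        rw [← hzeq, smul_smul, inv_mul_cancel₀ (by positivity), one_smul]
      rw [← this, hz]
      abel
    have h2 : ∀ s t : ℝ, 0 < t → q + s • d + t • w ∉ M := by
      intro s t ht hM'
      refine hv t ht ⟨_, hM', ?_⟩
      simp only [projAlong, inner_add_left, real_inner_smul_left, real_inner_self_eq_norm_sq, hd]
      rw [real_inner_comm d w, hdw]
      module
    obtain ⟨p, hp, hpM, hpQ, hpR⟩ := exists_mem_silhouette hM hQ hd hqM h1 h2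
    exact ⟨p, hp, hpM, hpQ, (mem_viewRay_iff hd p q).1 hpR⟩

/-! ### Perturbed sides of a triangle. -/

theorem smallestHeight_le {K : Geometry.SimplicialComplex ℝ E3} {t : Finset E3}
    (ht : t ∈ triangles K) {x v : E3} (hx : x ∈ convexHull ℝ (t : Set E3)) (hv : v ∈ t) :
    smallestHeight K x ≤ Metric.infDist v (affineSpan ℝ ((t : Set E3) \ {v}) : Set E3) := by
  refine csInf_le ⟨0, ?_⟩ ⟨t, ht, hx, v, hv, rfl⟩
  rintro _ ⟨t, -, -, v, -, rfl⟩
  exact Metric.infDist_nonneg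

theorem exists_eq_add_smul_of_mem_convexHull_pair {a c x : E3} (hx : x ∈ convexHull ℝ {a, c}) :
    ∃ l : ℝ, 0 ≤ l ∧ x = a + l • (c - a) := by
  rw [convexHull_pair, segment_eq_image'] at hx
  obtain ⟨l, hl, rfl⟩ := hx
  exact ⟨l, hl.1, rfl⟩

/-- Let `d` be far from the plane of the triangle `a b c`.  A point that is close to the edge `a c`
and at least as high, in the direction `w` orthogonal to the projection of `a b` and opposite to the
triangle, as some point that is close to `a b`, projects along `d` close to `a`. -/
theorem five_mul_inner_projAlong_le_of_mem_side {K : Geometry.SimplicialComplex ℝ E3}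
    {t : Finset E3} (ht : t ∈ triangles K) {a b c : E3} (htc : (t : Set E3) = {a, b, c})
    (hba : b ≠ a) (hbc : b ≠ c) {d w : E3} (hd : ‖d‖ = 1)
    (hw : w = cr (b - a) d ∨ w = -cr (b - a) d) (hside : ⟪c - a, w⟫ ≤ 0)
    (hD : ⟪faceNormal a b c, d⟫ ≠ 0) {δ : ℝ} (hδ : 0 < δ)
    (hn : 5 * δ * ‖faceNormal a b c‖ ≤ |⟪faceNormal a b c, d⟫|) {x q x₀ q₀ : E3}
    (hx : x ∈ convexHull ℝ {a, c}) (hq : ‖q - x‖ ≤ δ * smallestHeight K x)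
    (hx₀ : x₀ ∈ convexHull ℝ {a, b}) (hq₀ : ‖q₀ - x₀‖ ≤ δ * smallestHeight K x₀)
    (hle : ⟪q₀, w⟫ ≤ ⟪q, w⟫) :
    5 * ⟪q - a, projAlong d (b - a)⟫ ≤ 2 * ‖projAlong d (b - a)‖ ^ 2 := by
  have hbt : b ∈ t := by
    rw [← Finset.mem_coe, htc]; simp
  have hdiff : (t : Set E3) \ {b} = {a, c} := by
    rw [htc]
    ext y
    simp only [mem_sdiff, mem_insert_iff, mem_singleton_iff]
    constructor
    · rintro ⟨h | h | h, h'⟩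
      · exact Or.inl h
      · exact absurd h h'
      · exact Or.inr h
    · rintro (rfl | rfl)
      · exact ⟨Or.inl rfl, hba.symm⟩
      · exact ⟨Or.inr (Or.inr rfl), hbc.symm⟩
  -- The height over the side `a c`. It bounds the perturbation at both `x` and `x₀`, since both
  -- points lie in the triangle.
  set η := Metric.infDist b (affineSpan ℝ ({a, c} : Set E3) : Set E3) with hη
  have hxη : smallestHeight K x ≤ η := by
    rw [hη, ← hdiff]
    refine smallestHeight_le ht (convexHull_mono ?_ hx) hbt
    rw [htc]
    exact insert_subset_insert (by simp)
  have hxη₀ : smallestHeight K x₀ ≤ η := by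
    rw [hη, ← hdiff]
    refine smallestHeight_le ht (convexHull_mono ?_ hx₀) hbt
    rw [htc]
    exact insert_subset_insert (by simp)
  have hq' : ‖q - x‖ ≤ δ * η := hq.trans (mul_le_mul_of_nonneg_left hxη hδ.le)
  have hq₀' : ‖q₀ - x₀‖ ≤ δ * η := hq₀.trans (mul_le_mul_of_nonneg_left hxη₀ hδ.le)
  obtain ⟨l, hl, rfl⟩ := exists_eq_add_smul_of_mem_convexHull_pair hx
  obtain ⟨l₀, hl₀, rfl⟩ := exists_eq_add_smul_of_mem_convexHull_pair hx₀
  have hwn : ‖w‖ = ‖cr (b - a) d‖ := by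
    rcases hw with rfl | rfl
    · rfl
    · rw [norm_neg]
  have hwe : ⟪b - a, w⟫ = 0 := by
    rcases hw with rfl | rfl
    · exact inner_cr_left _ _
    · rw [inner_neg_right, inner_cr_left, neg_zero]
  have hqa : q - a = l • (c - a) + (q - (a + l • (c - a))) := by abel
  -- From below, `q` is no lower than `q₀`, which is close to the line `a b` of height zero; from
  -- above, `q` is close to the side `a c`, which does not rise above that line.
  have habs : |⟪q - a, w⟫| ≤ δ * η * ‖w‖ := by
    rw [abs_le]
    constructor
    · have h1 : ⟪q₀ - a, w⟫ = ⟪q₀ - (a + l₀ • (b - a)), w⟫ := by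
        rw [← sub_sub, inner_sub_left (q₀ - a), real_inner_smul_left, hwe, mul_zero, sub_zero]
      have h2 : ⟪q₀ - a, w⟫ ≤ ⟪q - a, w⟫ := by
        rw [inner_sub_left, inner_sub_left]; linarith
      have h3 := abs_le.1 (abs_real_inner_le_norm (q₀ - (a + l₀ • (b - a))) w)
      have h4 := mul_le_mul_of_nonneg_right hq₀' (norm_nonneg w)
      linarith [h3.1]
    · rw [hqa, inner_add_left, real_inner_smul_left]
      have h3 := real_inner_le_norm (q - (a + l • (c - a))) w
      have h4 := mul_le_mul_of_nonneg_right hq' (norm_nonneg w)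
      nlinarith
  have habs' : |⟪l • (c - a) + (q - (a + l • (c - a))), cr (b - a) d⟫| ≤
      δ * η * ‖cr (b - a) d‖ := by
    rw [← hqa, ← hwn]
    convert habs using 1
    rcases hw with rfl | rfl
    · rfl
    · rw [inner_neg_right, abs_neg]
  have hh := infDist_line_mul_le b a c
  rw [← hη] at hh
  rw [hqa]
  refine five_mul_inner_projAlong_le hd hq' habs' hD ?_
  rw [← faceNormal_eq_cr] at *
  -- `η * ‖c - a‖` is at most twice the area of the triangle, the norm of its face normal.
  calc 5 * (δ * η * ‖c - a‖) = 5 * δ * (η * ‖c - a‖) := by ring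
    _ ≤ 5 * δ * ‖faceNormal a b c‖ := by gcongr
    _ ≤ _ := hn

/-! ### Hinges: the two triangles at an edge. -/

/-- The triangles `t = a b c` and `t' = a b c'` are those that share the edge `e = a b`. -/
structure IsHinge (K : Geometry.SimplicialComplex ℝ E3) (e t t' : Finset E3) (a b c c' : E3) :
    Prop where
  mem_left : t ∈ triangles K
  mem_right : t' ∈ triangles K
  edge_eq : (e : Set E3) = {a, b}
  left_eq : (t : Set E3) = {a, b, c}
  right_eq : (t' : Set E3) = {a, b, c'}
  ne_edge : a ≠ b
  ne_left : a ≠ c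
  ne_left' : b ≠ c
  ne_right : a ≠ c'
  ne_right' : b ≠ c'
  ne : t ≠ t'
  eq_or_eq : ∀ s ∈ triangles K, e ⊆ s → s = t ∨ s = t'

theorem exists_eq_insert_of_edge_subset {e t : Finset E3} {a b : E3} (he : (e : Set E3) = {a, b})
    (hab : a ≠ b) (hcard : t.card = 3) (het : e ⊆ t) :
    ∃ c, (t : Set E3) = {a, b, c} ∧ a ≠ c ∧ b ≠ c := by
  classical
  have he' : e = {a, b} := by
    apply Finset.coe_injective
    rw [he]; simp
  have hec : e.card = 2 := by rw [he', Finset.card_pair hab]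
  have h1 : (t \ e).card = 1 := by rw [Finset.card_sdiff_of_subset het]; omega
  obtain ⟨c, hc⟩ := Finset.card_eq_one.1 h1
  have hc' : c ∈ t \ e := by rw [hc]; simp
  rw [Finset.mem_sdiff, he'] at hc'
  refine ⟨c, ?_, ?_, ?_⟩
  · have : t = e ∪ (t \ e) := (Finset.union_sdiff_of_subset het).symm
    rw [this, hc, he']
    push_cast
    ext y
    simp only [mem_union, mem_insert_iff, mem_singleton_iff, or_assoc]
  · rintro rfl
    exact hc'.2 (by simp)
  · rintro rfl
    exact hc'.2 (by simp)

theorem exists_isHinge {K : Geometry.SimplicialComplex ℝ E3} (hK : IsPolyhedron K) {e : Finset E3}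
    (he : e ∈ edges K) : ∃ t t' a b c c', IsHinge K e t t' a b c c' := by
  classical
  obtain ⟨t, t', hne, heq⟩ := ncard_eq_two.1 (hK.2.2 e he)
  obtain ⟨a, b, hab, heab⟩ := Finset.card_eq_two.1 he.2
  have hcoe : (e : Set E3) = {a, b} := by rw [heab]; simp
  have ht : t ∈ {t | t ∈ triangles K ∧ e ⊆ t} := by rw [heq]; simp
  have ht' : t' ∈ {t | t ∈ triangles K ∧ e ⊆ t} := by rw [heq]; simp
  obtain ⟨c, hc, hac, hbc⟩ := exists_eq_insert_of_edge_subset hcoe hab ht.1.2 ht.2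
  obtain ⟨c', hc', hac', hbc'⟩ := exists_eq_insert_of_edge_subset hcoe hab ht'.1.2 ht'.2
  refine ⟨t, t', a, b, c, c', ht.1, ht'.1, hcoe, hc, hc', hab, hac, hbc, hac', hbc', hne, ?_⟩
  intro s hs hes
  have : s ∈ {t | t ∈ triangles K ∧ e ⊆ t} := ⟨hs, hes⟩
  rw [heq] at this
  simpa using this

/-- The outer edges of the hinge formed by the triangles `a b c` and `a b c'`. -/
def hingeRim (a b c c' : E3) : Set E3 :=
  (convexHull ℝ {a, c} ∪ convexHull ℝ {b, c}) ∪ (convexHull ℝ {a, c'} ∪ convexHull ℝ {b, c'})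

/-- The part of the polyhedron outside the relatively open hinge around the edge `e`. -/
def hingeRest (K : Geometry.SimplicialComplex ℝ E3) (e : Finset E3) (a b c c' : E3) : Set E3 :=
  (⋃ s ∈ {s | s ∈ triangles K ∧ ¬ e ⊆ s}, convexHull ℝ (s : Set E3)) ∪ hingeRim a b c c'

theorem hingeRim_swap (a b c c' : E3) : hingeRim b a c c' = hingeRim a b c c' := by
  unfold hingeRim
  rw [union_comm (convexHull ℝ {b, c}), union_comm (convexHull ℝ {b, c'})]

theorem hingeRest_swap (K : Geometry.SimplicialComplex ℝ E3) (e : Finset E3) (a b c c' : E3) :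
    hingeRest K e b a c c' = hingeRest K e a b c c' := by
  unfold hingeRest
  rw [hingeRim_swap]

theorem IsHinge.swap {K : Geometry.SimplicialComplex ℝ E3} {e t t' : Finset E3} {a b c c' : E3}
    (h : IsHinge K e t t' a b c c') : IsHinge K e t t' b a c c' where
  mem_left := h.mem_left
  mem_right := h.mem_right
  edge_eq := by rw [h.edge_eq, pair_comm]
  left_eq := by rw [h.left_eq, insert_comm]
  right_eq := by rw [h.right_eq, insert_comm]
  ne_edge := h.ne_edge.symm
  ne_left := h.ne_left'
  ne_left' := h.ne_left
  ne_right := h.ne_right'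
  ne_right' := h.ne_right
  ne := h.ne
  eq_or_eq := h.eq_or_eq

theorem finite_triangles {K : Geometry.SimplicialComplex ℝ E3} (hK : IsPolyhedron K) :
    (triangles K).Finite := hK.1.subset fun _ ht ↦ ht.1

theorem finite_edges {K : Geometry.SimplicialComplex ℝ E3} (hK : IsPolyhedron K) :
    (edges K).Finite := hK.1.subset fun _ ht ↦ ht.1

theorem isCompact_convexHull_pair (a b : E3) : IsCompact (convexHull ℝ ({a, b} : Set E3)) :=
  (Set.toFinite _).isCompact_convexHull (𝕜 := ℝ)

theorem isCompact_hingeRest {K : Geometry.SimplicialComplex ℝ E3} (hK : IsPolyhedron K)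
    (e : Finset E3) (a b c c' : E3) : IsCompact (hingeRest K e a b c c') := by
  refine IsCompact.union ?_ (((isCompact_convexHull_pair a c).union
    (isCompact_convexHull_pair b c)).union
    ((isCompact_convexHull_pair a c').union (isCompact_convexHull_pair b c')))
  apply ((finite_triangles hK).subset fun s hs ↦ hs.1).isCompact_biUnion
  intro s _
  exact s.finite_toSet.isCompact_convexHull (𝕜 := ℝ)

theorem isCompact_space {K : Geometry.SimplicialComplex ℝ E3} (hK : IsPolyhedron K) :
    IsCompact K.space :=
  hK.1.isCompact_biUnion fun s _ ↦ s.finite_toSet.isCompact_convexHull (𝕜 := ℝ)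

theorem exists_mem_convexHull_triangle {K : Geometry.SimplicialComplex ℝ E3} (hK : IsPolyhedron K)
    {x : E3} (hx : x ∈ K.space) : ∃ t ∈ triangles K, x ∈ convexHull ℝ (t : Set E3) := by
  obtain ⟨s, hs, hxs⟩ := Geometry.SimplicialComplex.mem_space_iff.1 hx
  obtain ⟨t, ht, hst⟩ := hK.2.1 s hs
  exact ⟨t, ht, convexHull_mono (by exact_mod_cast hst) hxs⟩

theorem IsHinge.space_subset {K : Geometry.SimplicialComplex ℝ E3} (hK : IsPolyhedron K)
    {e t t' : Finset E3} {a b c c' : E3} (h : IsHinge K e t t' a b c c') {x : E3}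
    (hx : x ∈ K.space) : x ∈ convexHull ℝ (t : Set E3) ∪ convexHull ℝ (t' : Set E3) ∨
      x ∈ hingeRest K e a b c c' := by
  obtain ⟨s, hs, hxs⟩ := exists_mem_convexHull_triangle hK hx
  by_cases hes : e ⊆ s
  · left
    rcases h.eq_or_eq s hs hes with rfl | rfl
    · exact Or.inl hxs
    · exact Or.inr hxs
  · right; left
    simp only [mem_iUnion]
    exact ⟨s, ⟨hs, hes⟩, hxs⟩

/-- Simplices of a complex meet in the hull of their common vertices, and `s` misses `a` or `b`. -/
theorem mem_convexHull_pair_of_mem_inter {K : Geometry.SimplicialComplex ℝ E3} {e s t : Finset E3}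
    {a b c x : E3} (he : (e : Set E3) = {a, b}) (ht : t ∈ triangles K)
    (htc : (t : Set E3) = {a, b, c}) (hs : s ∈ triangles K) (hes : ¬ e ⊆ s)
    (hxt : x ∈ convexHull ℝ (t : Set E3)) (hxs : x ∈ convexHull ℝ (s : Set E3)) :
    x ∈ convexHull ℝ {a, c} ∪ convexHull ℝ {b, c} := by
  have hx := K.inter_subset_convexHull ht.1 hs.1 ⟨hxt, hxs⟩
  by_cases ha : a ∈ s
  · have hb : b ∉ s := by
      intro hb
      apply hes
      intro y hy
      rw [← Finset.mem_coe, he] at hy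
      rcases hy with rfl | rfl <;> assumption
    left
    refine convexHull_mono ?_ hx
    rintro y ⟨hy, hys⟩
    rw [htc] at hy
    rcases hy with rfl | rfl | rfl
    · simp
    · exact absurd hys hb
    · simp
  · right
    refine convexHull_mono ?_ hx
    rintro y ⟨hy, hys⟩
    rw [htc] at hy
    rcases hy with rfl | rfl | rfl
    · exact absurd hys ha
    · simp
    · simp

theorem IsHinge.mem_rim {K : Geometry.SimplicialComplex ℝ E3}
    {e t t' : Finset E3} {a b c c' : E3} (h : IsHinge K e t t' a b c c') {x : E3}
    (hx : x ∈ convexHull ℝ (t : Set E3) ∪ convexHull ℝ (t' : Set E3))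
    (hx' : x ∈ hingeRest K e a b c c') : x ∈ hingeRim a b c c' := by
  rcases hx' with hx' | hx'
  swap
  · exact hx'
  simp only [mem_iUnion] at hx'
  obtain ⟨s, ⟨hs, hes⟩, hxs⟩ := hx'
  rcases hx with hx | hx
  · exact Or.inl (mem_convexHull_pair_of_mem_inter h.edge_eq h.mem_left h.left_eq hs hes hx hxs)
  · exact Or.inr (mem_convexHull_pair_of_mem_inter h.edge_eq h.mem_right h.right_eq hs hes hx hxs)

/-! ### The silhouette arc near a hinge. -/

/-- The sign of the face normal against `d` tells on which side of the projected edge the apex lies: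
for a positive sign, the side away from `cr (b - a) d`. -/
theorem inner_sub_cr_eq (a b c d : E3) : ⟪c - a, cr (b - a) d⟫ = -⟪faceNormal a b c, d⟫ := by
  rw [faceNormal_eq_cr]
  simp only [inner_eq_coords, cr_apply_zero, cr_apply_one, cr_apply_two]
  ring

theorem projAlong_sub_comm (d a b : E3) : projAlong d (a - b) = -projAlong d (b - a) := by
  rw [← neg_sub, projAlong_neg]

theorem cr_sub_comm (d a b : E3) : cr (a - b) d = -cr (b - a) d := by
  rw [← neg_sub, cr_neg_left]

/-- A point of the perturbed outer edges of a triangle `a b c` that is at least as high as some point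
of the perturbed edge `a b` does not project over the middle fifth of the projection of `a b`. -/
theorem notMem_middle_of_mem_sides {K : Geometry.SimplicialComplex ℝ E3}
    {t : Finset E3} (ht : t ∈ triangles K) {a b c : E3} (htc : (t : Set E3) = {a, b, c})
    (hab : a ≠ b) (hac : a ≠ c) (hbc : b ≠ c) {d : E3} (hd : ‖d‖ = 1)
    (hD : 0 < ⟪faceNormal a b c, d⟫) {δ : ℝ} (hδ : 0 < δ)
    (hn : 5 * δ * ‖faceNormal a b c‖ ≤ |⟪faceNormal a b c, d⟫|) {x q x₀ q₀ : E3}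
    (hx : x ∈ convexHull ℝ {a, c} ∪ convexHull ℝ {b, c}) (hq : ‖q - x‖ ≤ δ * smallestHeight K x)
    (hx₀ : x₀ ∈ convexHull ℝ {a, b}) (hq₀ : ‖q₀ - x₀‖ ≤ δ * smallestHeight K x₀)
    (hle : ⟪q₀, cr (b - a) d⟫ ≤ ⟪q, cr (b - a) d⟫) :
    ¬ (2 * ‖projAlong d (b - a)‖ ^ 2 < 5 * ⟪q - a, projAlong d (b - a)⟫ ∧
      5 * ⟪q - a, projAlong d (b - a)⟫ < 3 * ‖projAlong d (b - a)‖ ^ 2) := by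
  rintro ⟨h1, h2⟩
  rcases hx with hx | hx
  · have := five_mul_inner_projAlong_le_of_mem_side ht htc hab.symm hbc hd (Or.inl rfl)
      (by rw [inner_sub_cr_eq]; linarith) hD.ne' hδ hn hx hq hx₀ hq₀ hle
    linarith
  -- The side `b c` is treated by exchanging `a` and `b`; the bound of `2/5` from `b` becomes at
  -- least `3/5` from `a`.
  · have := five_mul_inner_projAlong_le_of_mem_side (w := cr (b - a) d) ht
      (a := b) (b := a) (c := c) (by rw [htc, insert_comm]) hab hac hd
      (Or.inr (by rw [cr_sub_comm d a b, neg_neg]))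
      (by
        rw [← neg_neg (cr (b - a) d), ← cr_sub_comm, inner_neg_right, inner_sub_cr_eq,
          faceNormal_swap, inner_neg_left]
        linarith)
      (by rw [faceNormal_swap, inner_neg_left]; exact neg_ne_zero.2 hD.ne') hδ
      (by rw [faceNormal_swap, inner_neg_left, norm_neg, abs_neg]; exact hn) hx hq
      (by rwa [pair_comm]) hq₀ hle
    rw [projAlong_sub_comm, norm_neg, inner_neg_right] at this
    have h3 : ⟪q - a, projAlong d (b - a)⟫ =
        ⟪q - b, projAlong d (b - a)⟫ + ‖projAlong d (b - a)‖ ^ 2 := by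
      rw [← inner_self_projAlong hd, ← inner_add_left, sub_add_sub_cancel]
    linarith

section

variable {S : Set E3} {K : Geometry.SimplicialComplex ℝ E3} {e t t' : Finset E3} {a b c c' : E3}

/-- The silhouette arc associated with a hinge seen from a direction far from its two faces. -/
theorem IsHinge.exists_silhouette_arc_of_pos (hK : IsPolyhedron K)
    (h : IsHinge K e t t' a b c c') (f : K.space ≃ₜ S) {δ : ℝ} (hδ : 0 < δ)
    (hf : ∀ x : K.space, dist (x : E3) (f x : E3) < δ * smallestHeight K x) {d : E3} (hd : ‖d‖ = 1)
    (hpos : 0 < ⟪faceNormal a b c, d⟫) (hneg : ⟪faceNormal b a c', d⟫ < 0)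
    (hn : 5 * δ * ‖faceNormal a b c‖ ≤ |⟪faceNormal a b c, d⟫|)
    (hn' : 5 * δ * ‖faceNormal b a c'‖ ≤ |⟪faceNormal b a c', d⟫|) :
    ∃ A : Set E3, MeasurableSet A ∧ ENNReal.ofReal (‖projAlong d (b - a)‖ / 5) ≤ μH[1] A ∧
      ∀ v ∈ A, ∃ p ∈ silhouette S d, projAlong d p = v ∧
        ∃ x : K.space, (f x : E3) = p ∧ (x : E3) ∉ hingeRest K e a b c c' := by
  -- With both triangles described from `a` to `b`, the signs agree: the hinge projects as a fold,
  -- both apexes on the same side of `a b`.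
  have hpos' : 0 < ⟪faceNormal a b c', d⟫ := by
    rw [faceNormal_swap, inner_neg_left]; linarith
  rw [faceNormal_swap, inner_neg_left, norm_neg, abs_neg] at hn'
  set u := projAlong d (b - a) with hu
  set w := cr (b - a) d with hw
  have hcomp : CompactSpace K.space := isCompact_iff_compactSpace.1 (isCompact_space hK)
  set F : K.space → E3 := fun x ↦ (f x : E3) with hF
  have hFc : Continuous F := continuous_subtype_val.comp f.continuous
  have hFi : Function.Injective F := Subtype.val_injective.comp f.injective
  set T : Set E3 := convexHull ℝ (t : Set E3) ∪ convexHull ℝ (t' : Set E3) with hT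
  have hTc : IsCompact T :=
    (t.finite_toSet.isCompact_convexHull (𝕜 := ℝ)).union
      (t'.finite_toSet.isCompact_convexHull (𝕜 := ℝ))
  set Z := hingeRest K e a b c c' with hZ
  have hZc : IsCompact Z := isCompact_hingeRest hK e a b c c'
  set M : Set E3 := F '' (Subtype.val ⁻¹' T) with hM
  set Q : Set E3 := F '' (Subtype.val ⁻¹' Z) with hQ
  have hMc : IsCompact M :=
    ((hTc.isClosed.preimage continuous_subtype_val).isCompact).image hFc
  have hQc : IsCompact Q :=
    ((hZc.isClosed.preimage continuous_subtype_val).isCompact).image hFc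
  have hSMQ : M ∪ Q = S := by
    rw [hM, hQ, ← image_union]
    ext p
    constructor
    · rintro ⟨x, -, rfl⟩
      exact (f x).2
    · intro hp
      refine ⟨f.symm ⟨p, hp⟩, ?_, by simp [hF]⟩
      exact h.space_subset hK (f.symm ⟨p, hp⟩).2
  have hn0 : ∀ x : K.space, ‖F x - x‖ ≤ δ * smallestHeight K x := by
    intro x
    rw [← dist_eq_norm, dist_comm]
    exact (hf x).le
  have hrim : ∀ x : K.space, (x : E3) ∈ hingeRim a b c c' → ∀ x₀ : K.space,
      (x₀ : E3) ∈ convexHull ℝ {a, b} → ⟪F x₀, w⟫ ≤ ⟪F x, w⟫ →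
      ¬ (2 * ‖u‖ ^ 2 < 5 * ⟪F x - a, u⟫ ∧ 5 * ⟪F x - a, u⟫ < 3 * ‖u‖ ^ 2) := by
    intro x hx x₀ hx₀ hle
    rcases hx with hx | hx
    · exact notMem_middle_of_mem_sides h.mem_left h.left_eq h.ne_edge h.ne_left h.ne_left' hd hpos
        hδ hn hx (hn0 x) hx₀ (hn0 x₀) hle
    · exact notMem_middle_of_mem_sides h.mem_right h.right_eq h.ne_edge h.ne_right h.ne_right' hd
        hpos' hδ hn' hx (hn0 x) hx₀ (hn0 x₀) hle
  have hl : 0 < ‖u‖ := by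
    rw [hu, norm_projAlong hd, norm_pos_iff]
    intro h0
    have := inner_sub_cr_eq a b c d
    rw [h0, inner_zero_right] at this
    linarith
  have habT : convexHull ℝ ({a, b} : Set E3) ⊆ T := by
    refine subset_trans (convexHull_mono ?_) subset_union_left
    rw [h.left_eq]
    exact insert_subset_insert (by simp)
  have hTK : T ⊆ K.space := union_subset
    (Geometry.SimplicialComplex.convexHull_subset_space h.mem_left.1)
    (Geometry.SimplicialComplex.convexHull_subset_space h.mem_right.1)
  have hmem : ∀ s : unitInterval, a + (s : ℝ) • (b - a) ∈ convexHull ℝ ({a, b} : Set E3) := by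
    intro s
    rw [convexHull_pair, segment_eq_image']
    exact ⟨s, s.2, rfl⟩
  -- The image of the edge `a b` covers the middle fifth: its ends project outside it, on opposite
  -- sides, and the intermediate value theorem applies.
  have hdiv : ∀ τ, 2 * ‖u‖ ^ 2 < 5 * τ → 5 * τ < 3 * ‖u‖ ^ 2 →
      ∃ x₀ : K.space, (x₀ : E3) ∈ convexHull ℝ {a, b} ∧ ⟪F x₀ - a, u⟫ = τ := by
    intro τ h1 h2
    set γ : unitInterval → K.space := fun s ↦ ⟨a + (s : ℝ) • (b - a), hTK (habT (hmem s))⟩ with hγ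
    have hγc : Continuous γ := by
      apply Continuous.subtype_mk
      fun_prop
    have hg : Continuous fun s ↦ ⟪F (γ s) - a, u⟫ := by
      have := hFc.comp hγc
      fun_prop
    have e0 : ((γ 0 : K.space) : E3) = a := by simp [hγ]
    have e1 : ((γ 1 : K.space) : E3) = b := by simp [hγ]
    -- The end `a` belongs to both `a c` and `a b`, so the estimate applies with `x = x₀ = a`;
    -- likewise at `b` below.
    have k0 : 5 * ⟪F (γ 0) - a, u⟫ ≤ 2 * ‖u‖ ^ 2 :=
      five_mul_inner_projAlong_le_of_mem_side h.mem_left h.left_eq h.ne_edge.symm h.ne_left' hd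
        (w := w) (Or.inl rfl) (by rw [hw, inner_sub_cr_eq]; linarith) hpos.ne' hδ hn
        (x := γ 0) (x₀ := γ 0) (q₀ := F (γ 0))
        (by rw [e0]; exact subset_convexHull ℝ _ (by simp)) (hn0 _)
        (by rw [e0]; exact subset_convexHull ℝ _ (by simp)) (hn0 _) le_rfl
    have k1 : 5 * ⟪F (γ 1) - b, projAlong d (a - b)⟫ ≤ 2 * ‖projAlong d (a - b)‖ ^ 2 :=
      five_mul_inner_projAlong_le_of_mem_side (a := b) (b := a) (c := c) h.mem_left
        h.swap.left_eq h.ne_edge h.ne_left hd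
        (w := w) (Or.inr (by rw [cr_sub_comm d a b, neg_neg]))
        (by
          rw [hw, ← neg_neg (cr (b - a) d), ← cr_sub_comm, inner_neg_right, inner_sub_cr_eq,
            faceNormal_swap, inner_neg_left]
          linarith)
        (by rw [faceNormal_swap, inner_neg_left]; exact neg_ne_zero.2 hpos.ne') hδ
        (by rw [faceNormal_swap, inner_neg_left, norm_neg, abs_neg]; exact hn)
        (x := γ 1) (x₀ := γ 1) (q₀ := F (γ 1))
        (by rw [e1]; exact subset_convexHull ℝ _ (by simp)) (hn0 _)
        (by rw [e1]; exact subset_convexHull ℝ _ (by simp)) (hn0 _) le_rfl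
    rw [projAlong_sub_comm, norm_neg, inner_neg_right, ← hu] at k1
    have k2 : ⟪F (γ 1) - a, u⟫ = ⟪F (γ 1) - b, u⟫ + ‖u‖ ^ 2 := by
      rw [hu, ← inner_self_projAlong hd, ← inner_add_left, sub_add_sub_cancel]
    have hivt := intermediate_value_univ (0 : unitInterval) 1 hg
    obtain ⟨s, hs⟩ := hivt (show τ ∈ Icc ⟪F (γ 0) - a, u⟫ ⟪F (γ 1) - a, u⟫ from
      ⟨by linarith, by linarith⟩)
    exact ⟨γ s, hmem s, hs⟩
  obtain ⟨A, hAm, hAl, hA⟩ := exists_silhouette_arc hMc hQc (e := b - a) (a := a) hd hl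
    (by
      intro τ h1 h2
      obtain ⟨x₀, hx₀, hτ⟩ := hdiv τ h1 h2
      exact ⟨F x₀, mem_image_of_mem _ (habT hx₀), hτ⟩)
    (by
      intro q hqM hqQ h1 h2
      obtain ⟨x, hxT, rfl⟩ := hqM
      obtain ⟨x', hxZ, hxx⟩ := hqQ
      obtain rfl := hFi hxx
      -- A point of `M ∩ Q` comes from the rim. The image of a point of the edge with the same
      -- abscissa is strictly higher, for otherwise `hrim` would exclude the middle fifth.
      obtain ⟨x₀, hx₀, hτ⟩ := hdiv _ h1 h2
      refine ⟨F x₀, mem_image_of_mem _ (habT hx₀), hτ, ?_⟩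
      by_contra hc
      rw [not_lt, inner_sub_left, inner_sub_left] at hc
      exact hrim x' (h.mem_rim hxT hxZ) x₀ hx₀ (by rw [hw]; linarith) ⟨h1, h2⟩)
  refine ⟨A, hAm, hAl, ?_⟩
  intro v hv
  obtain ⟨p, hp, hpM, hpQ, hpv⟩ := hA v hv
  rw [hSMQ] at hp
  obtain ⟨x, hxT, rfl⟩ := hpM
  exact ⟨F x, hp, hpv, x, rfl, fun hx ↦ hpQ (mem_image_of_mem _ hx)⟩

/-- The two halves of the double wedge are exchanged by swapping the end points of the edge, which
reverses both normals. -/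
theorem IsHinge.exists_silhouette_arc (hK : IsPolyhedron K)
    (h : IsHinge K e t t' a b c c') (f : K.space ≃ₜ S) {δ : ℝ} (hδ : 0 < δ)
    (hf : ∀ x : K.space, dist (x : E3) (f x : E3) < δ * smallestHeight K x) {d : E3} (hd : ‖d‖ = 1)
    (hdw : d ∈ wideWedge (faceNormal a b c) (faceNormal b a c') (5 * δ)) :
    ∃ A : Set E3, MeasurableSet A ∧ ENNReal.ofReal (‖projAlong d (b - a)‖ / 5) ≤ μH[1] A ∧
      ∀ v ∈ A, ∃ p ∈ silhouette S d, projAlong d p = v ∧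
        ∃ x : K.space, (f x : E3) = p ∧ (x : E3) ∉ hingeRest K e a b c c' := by
  obtain ⟨hW, hn, hn'⟩ := hdw
  have hW' : ⟪faceNormal a b c, d⟫ * ⟪faceNormal b a c', d⟫ < 0 := hW
  rcases mul_neg_iff.1 hW' with ⟨h1, h2⟩ | ⟨h1, h2⟩
  · exact h.exists_silhouette_arc_of_pos hK f hδ hf hd h1 h2 hn hn'
  · have := h.swap.exists_silhouette_arc_of_pos hK f hδ hf hd
      (by rw [faceNormal_swap, inner_neg_left]; linarith)
      (by rw [faceNormal_swap, inner_neg_left]; linarith)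
      (by rwa [faceNormal_swap, inner_neg_left, norm_neg, abs_neg])
      (by rwa [faceNormal_swap, inner_neg_left, norm_neg, abs_neg])
    rwa [projAlong_sub_comm, norm_neg, hingeRest_swap] at this

end

/-! ### Silhouette edges, wedges and the number of edges. -/

theorem eq_of_insert_insert_eq {a b c c' : E3} (h : ({a, b, c} : Set E3) = {a, b, c'})
    (ha : a ≠ c) (hb : b ≠ c) : c' = c := by
  have : c ∈ ({a, b, c'} : Set E3) := by rw [← h]; simp
  rcases this with h | h | h
  · exact absurd h.symm ha
  · exact absurd h.symm hb
  · exact h.symm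

/-- The labels in the front-back condition are those of the hinge up to exchanging the end points or
the two faces, and none of these changes affects the sign of the product. -/
theorem IsHinge.mem_doubleWedge {K : Geometry.SimplicialComplex ℝ E3} {e t t' : Finset E3}
    {a b c c' : E3} (h : IsHinge K e t t' a b c c') {d : E3} (hs : SeparatesFrontBack K d e) :
    d ∈ doubleWedge (faceNormal a b c) (faceNormal b a c') := by
  obtain ⟨a₁, b₁, c₁, c₁', s, hs, s', hs', hne, hab, hsc, hsc', hp, hn⟩ := hs
  have hes : e ⊆ s := by
    rw [← Finset.coe_subset, hab, hsc]
    exact insert_subset_insert (by simp)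
  have hes' : e ⊆ s' := by
    rw [← Finset.coe_subset, hab, hsc', insert_comm]
    exact insert_subset_insert (by simp)
  have key : ∀ x y z z' : E3, IsHinge K e t t' x y c c' → (s : Set E3) = {x, y, z} →
      (s' : Set E3) = {y, x, z'} → (z = c ∧ z' = c') ∨ (z = c' ∧ z' = c) := by
    intro x y z z' hh hz hz'
    rw [insert_comm] at hz'
    rcases h.eq_or_eq s hs hes with rfl | rfl
    · rcases h.eq_or_eq s' hs' hes' with rfl | rfl
      · exact absurd rfl hne
      · exact Or.inl ⟨eq_of_insert_insert_eq (hh.left_eq.symm.trans hz) hh.ne_left hh.ne_left',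
          eq_of_insert_insert_eq (hh.right_eq.symm.trans hz') hh.ne_right hh.ne_right'⟩
    · rcases h.eq_or_eq s' hs' hes' with rfl | rfl
      · exact Or.inr ⟨eq_of_insert_insert_eq (hh.right_eq.symm.trans hz) hh.ne_right hh.ne_right',
          eq_of_insert_insert_eq (hh.left_eq.symm.trans hz') hh.ne_left hh.ne_left'⟩
      · exact absurd rfl hne
  simp only [doubleWedge, mem_ofPred_eq]
  have hpair : ({a, b} : Set E3) = {a₁, b₁} := by rw [← hab, h.edge_eq]
  rw [pair_eq_pair_iff] at hpair
  have hsw : ∀ x y z : E3, ⟪faceNormal y x z, d⟫ = -⟪faceNormal x y z, d⟫ := fun x y z ↦ by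
    rw [faceNormal_swap, inner_neg_left]
  rcases hpair with ⟨rfl, rfl⟩ | ⟨rfl, rfl⟩
  · rcases key _ _ _ _ h hsc hsc' with ⟨rfl, rfl⟩ | ⟨rfl, rfl⟩
    · exact mul_neg_of_pos_of_neg hp hn
    · exact mul_neg_of_pos_of_neg (by linarith [hsw a b c₁']) (by linarith [hsw a b c₁])
  · rcases key _ _ _ _ h.swap hsc hsc' with ⟨rfl, rfl⟩ | ⟨rfl, rfl⟩
    · exact mul_neg_of_neg_of_pos (by linarith [hsw a b c₁]) (by linarith [hsw a b c₁'])
    · exact mul_neg_of_neg_of_pos hn hp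

/-- Each of the finitely many face planes has dimension at most two. The edge-on clause of
`silhouetteEdges` thus contributes nothing to the expectation. -/
theorem ae_not_seenEdgeOn {K : Geometry.SimplicialComplex ℝ E3} (hK : IsPolyhedron K) :
    ∀ᵐ d : Viewpoint ∂uniformViewpoint, ∀ t ∈ triangles K, ¬ SeenEdgeOn d t := by
  classical
  rw [ae_ball_iff (finite_triangles hK).countable]
  intro t ht
  apply ae_notMem_submodule
  intro htop
  have h1 := finrank_vectorSpan_image_finset_le (k := ℝ) (id : E3 → E3) t (n := 2) (by rw [ht.2])
  rw [Finset.image_id] at h1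
  rw [direction_affineSpan] at htop
  rw [htop, finrank_top] at h1
  simp at h1

/-- Double counting of incidences: an edge is in exactly two triangles, a triangle has at most three
edges. -/
theorem two_mul_card_edges_le {K : Geometry.SimplicialComplex ℝ E3} (hK : IsPolyhedron K) :
    (finite_edges hK).toFinset.card * 2 ≤ (triangles K).ncard * 3 := by
  classical
  rw [ncard_eq_toFinset_card _ (finite_triangles hK)]
  apply Finset.card_mul_le_card_mul (fun e t : Finset E3 ↦ e ⊆ t)
  · intro e he
    rw [Finite.mem_toFinset] at he
    rw [← hK.2.2 e he, ← Set.ncard_coe_finset]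
    apply le_of_eq
    congr 1
    ext t
    simp [Finset.bipartiteAbove]
  · intro t ht
    rw [Finite.mem_toFinset] at ht
    have hsub : Finset.bipartiteBelow (fun e t : Finset E3 ↦ e ⊆ t) (finite_edges hK).toFinset t ⊆
        t.powersetCard 2 := by
      intro e he
      rw [Finset.mem_bipartiteBelow, Finite.mem_toFinset] at he
      exact Finset.mem_powersetCard.2 ⟨he.2, he.1.2⟩
    refine (Finset.card_le_card hsub).trans_eq ?_
    rw [Finset.card_powersetCard, ht.2]
    rfl

/-! ### Summation over the edges and the final constants. -/

section

variable {S : Set E3} {K : Geometry.SimplicialComplex ℝ E3}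

/-- The arcs of the silhouette of `S` near the edges of `K` bound its length from below: each point of
the silhouette is on at most three of them. -/
theorem sum_norm_projAlong_le_silhouetteLength (hK : IsPolyhedron K) (f : K.space ≃ₜ S) {δ : ℝ}
    (hδ : 0 < δ) (hf : ∀ x : K.space, dist (x : E3) (f x : E3) < δ * smallestHeight K x)
    {t t' : Finset E3 → Finset E3} {a b c c' : Finset E3 → E3}
    (h : ∀ e ∈ edges K, IsHinge K e (t e) (t' e) (a e) (b e) (c e) (c' e)) (d : Viewpoint) :
    ∑ e ∈ (finite_edges hK).toFinset, ENNReal.ofReal (‖projAlong d (b e - a e)‖ / 5) *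
      (wideWedge (faceNormal (a e) (b e) (c e)) (faceNormal (b e) (a e) (c' e))
        (5 * δ)).indicator 1 (d : E3) ≤ 3 * silhouetteLength S d := by
  classical
  have hd : ‖(d : E3)‖ = 1 := by simp
  have hA : ∀ e ∈ edges K, ∃ A : Set E3, MeasurableSet A ∧
      ENNReal.ofReal (‖projAlong d (b e - a e)‖ / 5) *
      (wideWedge (faceNormal (a e) (b e) (c e)) (faceNormal (b e) (a e) (c' e))
        (5 * δ)).indicator 1 (d : E3) ≤ μH[1] A ∧
      ∀ v ∈ A, ∃ p ∈ silhouette S d, projAlong d p = v ∧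
        ∃ x : K.space, (f x : E3) = p ∧ (x : E3) ∉ hingeRest K e (a e) (b e) (c e) (c' e) := by
    intro e he
    by_cases hw : (d : E3) ∈ wideWedge (faceNormal (a e) (b e) (c e))
        (faceNormal (b e) (a e) (c' e)) (5 * δ)
    · obtain ⟨A, h1, h2, h3⟩ := (h e he).exists_silhouette_arc hK f hδ hf hd hw
      exact ⟨A, h1, by simpa [hw] using h2, h3⟩
    · exact ⟨∅, MeasurableSet.empty, by simp [hw], by simp⟩
  choose! A hAm hAl hA using hA
  set E := (finite_edges hK).toFinset with hE
  have hEe : ∀ e ∈ E, e ∈ edges K := fun e he ↦ (Finite.mem_toFinset _).1 he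
  have hpt : ∀ v : E3, ∑ e ∈ E, (A e).indicator (1 : E3 → ℝ≥0∞) v ≤
      3 * (({p | p ∈ silhouette S d ∧ projAlong d p = v}.encard : ℕ∞) : ℝ≥0∞) := by
    intro v
    set E' := E.filter (fun e ↦ v ∈ A e) with hE'
    have hsum : ∑ e ∈ E, (A e).indicator (1 : E3 → ℝ≥0∞) v = (E'.card : ℝ≥0∞) := by
      rw [hE', Finset.card_filter]
      push_cast
      apply Finset.sum_congr rfl
      intro e _
      simp [indicator]
    have hp : ∀ e ∈ E', ∃ p ∈ silhouette S d, projAlong d p = v ∧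
        ∃ x : K.space, (f x : E3) = p ∧ (x : E3) ∉ hingeRest K e (a e) (b e) (c e) (c' e) := by
      intro e he
      rw [hE', Finset.mem_filter] at he
      exact hA e (hEe e he.1) v he.2
    choose! p hps hpv hpx using hp
    have hcard : E'.card ≤ 3 * (E'.image p).card := by
      apply Finset.card_le_mul_card_image
      intro q hq
      obtain ⟨e₀, he₀, rfl⟩ := Finset.mem_image.1 hq
      obtain ⟨x, hx, -⟩ := hpx e₀ he₀
      obtain ⟨s, hs, hxs⟩ := exists_mem_convexHull_triangle hK x.2
      -- Fix a triangle `s` containing the preimage `x`. An edge not contained in `s` would put `s`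
      -- into the rest of its hinge, which `x` avoids; so all edges sharing this silhouette point
      -- are among the three pairs of vertices of `s`.
      have hsub : E'.filter (fun e ↦ p e = p e₀) ⊆ s.powersetCard 2 := by
        intro e he
        rw [Finset.mem_filter] at he
        have heK := hEe e (Finset.mem_filter.1 he.1).1
        refine Finset.mem_powersetCard.2 ⟨?_, heK.2⟩
        obtain ⟨y, hy, hyr⟩ := hpx e he.1
        have hxy : y = x := f.injective (Subtype.val_injective (by rw [hy, hx, he.2]))
        by_contra hes
        apply hyr
        left
        simp only [mem_iUnion]
        exact ⟨s, ⟨hs, hes⟩, by rw [hxy]; exact hxs⟩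
      refine (Finset.card_le_card hsub).trans_eq ?_
      rw [Finset.card_powersetCard, hs.2]
      rfl
    have hle : ((E'.image p).card : ℕ∞) ≤ {p | p ∈ silhouette S d ∧ projAlong d p = v}.encard := by
      rw [← encard_coe_eq_coe_finsetCard]
      apply encard_le_encard
      intro q hq
      obtain ⟨e, he, rfl⟩ := Finset.mem_image.1 (Finset.mem_coe.1 hq)
      exact ⟨hps e he, hpv e he⟩
    rw [hsum]
    calc (E'.card : ℝ≥0∞) ≤ ((3 * (E'.image p).card : ℕ) : ℝ≥0∞) := by exact_mod_cast hcard
      _ = 3 * (((E'.image p).card : ℕ∞) : ℝ≥0∞) := by push_cast; rfl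
      _ ≤ _ := by
        gcongr
  calc _ ≤ ∑ e ∈ E, μH[1] (A e) := Finset.sum_le_sum fun e he ↦ hAl e (hEe e he)
    _ = ∑ e ∈ E, ∫⁻ v : E3, (A e).indicator 1 v ∂μH[1] := by
      apply Finset.sum_congr rfl
      intro e he
      rw [lintegral_indicator_one (hAm e (hEe e he))]
    _ = ∫⁻ v : E3, ∑ e ∈ E, (A e).indicator 1 v ∂μH[1] := by
      rw [lintegral_finsetSum]
      intro e he
      exact measurable_one.indicator (hAm e (hEe e he))
    _ ≤ ∫⁻ v : E3, 3 * (({p | p ∈ silhouette S d ∧ projAlong d p = v}.encard : ℕ∞) : ℝ≥0∞)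
        ∂μH[1] := lintegral_mono hpt
    _ = _ := by
      -- A finite constant comes out without measurability of the multiplicity function.
      rw [lintegral_const_mul' _ _ (by norm_num)]
      rfl

theorem expectedSilhouetteSize_le_sum (hK : IsPolyhedron K)
    {t t' : Finset E3 → Finset E3} {a b c c' : Finset E3 → E3}
    (h : ∀ e ∈ edges K, IsHinge K e (t e) (t' e) (a e) (b e) (c e) (c' e)) :
    expectedSilhouetteSize K ≤ ∑ e ∈ (finite_edges hK).toFinset, ∫⁻ d : Viewpoint,
      (doubleWedge (faceNormal (a e) (b e) (c e)) (faceNormal (b e) (a e) (c' e))).indicator 1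
        (d : E3) ∂uniformViewpoint := by
  classical
  set E := (finite_edges hK).toFinset with hE
  have hEe : ∀ e, e ∈ E ↔ e ∈ edges K := fun e ↦ Finite.mem_toFinset _
  rw [← lintegral_finsetSum]
  swap
  · intro e _
    exact (measurable_one.indicator (measurableSet_doubleWedge _ _)).comp measurable_subtype_coe
  apply lintegral_mono_ae
  filter_upwards [ae_not_seenEdgeOn hK] with d hd
  set E' := E.filter (fun e ↦ (d : E3) ∈
    doubleWedge (faceNormal (a e) (b e) (c e)) (faceNormal (b e) (a e) (c' e))) with hE'
  have hsub : silhouetteEdges K d ⊆ (E' : Set (Finset E3)) := by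
    rintro e ⟨he, hs | ⟨⟨s, hs, -, hse⟩, -⟩⟩
    · rw [hE', Finset.mem_coe, Finset.mem_filter]
      exact ⟨(hEe e).2 he, (h e he).mem_doubleWedge hs⟩
    · exact absurd hse (hd s hs)
  have hcard := encard_le_encard hsub
  rw [encard_coe_eq_coe_finsetCard] at hcard
  calc (((silhouetteEdges K d).encard : ℕ∞) : ℝ≥0∞) ≤ (((E'.card : ℕ) : ℕ∞) : ℝ≥0∞) := by
        gcongr
    _ = (E'.card : ℝ≥0∞) := by rfl
    _ = _ := by
      rw [hE', Finset.card_filter]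
      push_cast
      apply Finset.sum_congr rfl
      intro e _
      simp [indicator]

theorem Approximates.expectedSilhouetteSize_le {α β : ℝ} (hα : 0 < α) (hβ : 0 < β)
    (hfin : silh S ≠ ∞) {n : ℕ} {f : K.space ≃ₜ S} (hap : Approximates S α β n K f) :
    expectedSilhouetteSize K ≤
      ENNReal.ofReal ((15 * β + 24 / α * (silh S).toReal) * √(n : ℝ)) := by
  have hK := hap.polyhedron
  have hh : ∀ e ∈ edges K, ∃ t t' a b c c', IsHinge K e t t' a b c c' :=
    fun e he ↦ exists_isHinge hK he
  choose! t t' a b c c' h using hh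
  have hsize := expectedSilhouetteSize_le_sum hK h
  have hcardE := two_mul_card_edges_le hK
  rw [hap.card_triangles] at hcardE
  set E := (finite_edges hK).toFinset with hE
  have hEe : ∀ e ∈ E, e ∈ edges K := fun e he ↦ (Finite.mem_toFinset _).1 he
  rcases Nat.eq_zero_or_pos n with hn | hn
  · have : E = ∅ := Finset.card_eq_zero.1 (by omega)
    rw [this] at hsize
    simpa using hsize.trans (zero_le)
  have hn' : (0 : ℝ) < n := by exact_mod_cast hn
  have hsn : 0 < √(n : ℝ) := Real.sqrt_pos.2 hn'
  set δ := β / √(n : ℝ) with hδdef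
  have hδ : 0 < δ := by positivity
  have hf : ∀ x : K.space, dist (x : E3) (f x : E3) < δ * smallestHeight K x := by
    intro x
    have := hap.dist_lt x
    rw [hδdef, div_mul_eq_mul_div]
    exact this
  set G : Finset E3 → Set E3 := fun e ↦
    wideWedge (faceNormal (a e) (b e) (c e)) (faceNormal (b e) (a e) (c' e)) (5 * δ) with hG
  have hGm : ∀ e, Measurable ((G e).indicator (1 : E3 → ℝ≥0∞)) := fun e ↦
    measurable_one.indicator (measurableSet_wideWedge _ _ _)
  have hedge : ∀ e ∈ E, ∫⁻ d : Viewpoint,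
      (doubleWedge (faceNormal (a e) (b e) (c e)) (faceNormal (b e) (a e) (c' e))).indicator 1
        (d : E3) ∂uniformViewpoint ≤ ENNReal.ofReal (10 * δ) + ENNReal.ofReal (3 / 2) *
        ∫⁻ d : Viewpoint, ENNReal.ofReal (sinAngle (b e - a e) d) * (G e).indicator 1 (d : E3)
          ∂uniformViewpoint := by
    intro e he
    refine uniformViewpoint_doubleWedge_le (b e - a e) _ _
      (sub_ne_zero.2 (h e (hEe e he)).ne_edge.symm) (inner_edge_faceNormal _ _ _) ?_ δ hδ
    rw [faceNormal_swap, inner_neg_right, inner_edge_faceNormal, neg_zero]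
  -- The sine is projected length over length, and the length is at least `α / √n`; the `5` undoes
  -- the fifth in the arc length.
  have hsin : ∀ e ∈ E, ∀ d : Viewpoint, ENNReal.ofReal (sinAngle (b e - a e) d) ≤
      ENNReal.ofReal (5 * √(n : ℝ) / α) * ENNReal.ofReal (‖projAlong d (b e - a e)‖ / 5) := by
    intro e he d
    have hhe := h e (hEe e he)
    have hlen : α / √(n : ℝ) ≤ ‖b e - a e‖ := by
      rw [← dist_eq_norm]
      refine hap.edge_length e (hEe e he) _ ?_ _ ?_ hhe.ne_edge.symm
      · rw [← Finset.mem_coe, hhe.edge_eq]; simp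
      · rw [← Finset.mem_coe, hhe.edge_eq]; simp
    have hlen0 : 0 < ‖b e - a e‖ := lt_of_lt_of_le (by positivity) hlen
    rw [← ENNReal.ofReal_mul (by positivity)]
    apply ENNReal.ofReal_le_ofReal
    rw [sinAngle, div_le_iff₀ hlen0]
    rw [div_le_iff₀ hsn] at hlen
    have h1 : 1 ≤ √(n : ℝ) / α * ‖b e - a e‖ := by
      rw [div_mul_eq_mul_div, one_le_div hα]
      linarith
    have h2 := mul_le_mul_of_nonneg_left h1 (norm_nonneg (projAlong d (b e - a e)))
    calc _ ≤ ‖projAlong d (b e - a e)‖ * (√(n : ℝ) / α * ‖b e - a e‖) := by linarith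
      _ = _ := by ring
  have hlength : ∑ e ∈ E, ∫⁻ d : Viewpoint, ENNReal.ofReal (sinAngle (b e - a e) d) *
      (G e).indicator 1 (d : E3) ∂uniformViewpoint ≤
      ENNReal.ofReal (5 * √(n : ℝ) / α) * (3 * silh S) := by
    rw [← lintegral_finsetSum _ fun e _ ↦ by
      have := hGm e
      fun_prop]
    calc _ ≤ ∫⁻ d : Viewpoint, ENNReal.ofReal (5 * √(n : ℝ) / α) * (3 * silhouetteLength S d)
          ∂uniformViewpoint := by
          apply lintegral_mono
          intro d
          refine le_trans ?_ (mul_le_mul_right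
            (sum_norm_projAlong_le_silhouetteLength hK f hδ hf h d) _)
          rw [Finset.mul_sum]
          apply Finset.sum_le_sum
          intro e he
          rw [← mul_assoc]
          exact mul_le_mul_left (hsin e he d) _
      _ = _ := by
          rw [lintegral_const_mul' _ _ ENNReal.ofReal_ne_top,
            lintegral_const_mul' _ _ (by norm_num)]
          rfl
  -- At most `3n/2` edges, each costing `10β / √n`.
  have hcard : (E.card : ℝ) * (10 * δ) ≤ 15 * β * √(n : ℝ) := by
    have h1 : (E.card : ℝ) * 2 ≤ n * 3 := by exact_mod_cast hcardE
    have h2 : √(n : ℝ) * √(n : ℝ) = n := Real.mul_self_sqrt hn'.le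
    rw [hδdef, mul_div_assoc', mul_div_assoc', div_le_iff₀ hsn]
    nlinarith
  have hs0 : 0 ≤ (silh S).toReal := ENNReal.toReal_nonneg
  calc expectedSilhouetteSize K ≤ ∑ e ∈ E, (ENNReal.ofReal (10 * δ) + ENNReal.ofReal (3 / 2) *
        ∫⁻ d : Viewpoint, ENNReal.ofReal (sinAngle (b e - a e) d) * (G e).indicator 1 (d : E3)
          ∂uniformViewpoint) := hsize.trans (Finset.sum_le_sum hedge)
    _ = E.card * ENNReal.ofReal (10 * δ) + ENNReal.ofReal (3 / 2) * ∑ e ∈ E,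
        ∫⁻ d : Viewpoint, ENNReal.ofReal (sinAngle (b e - a e) d) * (G e).indicator 1 (d : E3)
          ∂uniformViewpoint := by
        rw [Finset.sum_add_distrib, Finset.sum_const, nsmul_eq_mul, Finset.mul_sum]
    _ ≤ E.card * ENNReal.ofReal (10 * δ) + ENNReal.ofReal (3 / 2) *
        (ENNReal.ofReal (5 * √(n : ℝ) / α) * (3 * silh S)) := by gcongr
    -- `45/2 = 3/2 * 5 * 3`: the wedge formula, the middle fifth, and the multiplicity of the arcs.
    _ = ENNReal.ofReal (E.card * (10 * δ) + 45 / 2 / α * (silh S).toReal * √(n : ℝ)) := by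
        nth_rewrite 1 [← ENNReal.ofReal_toReal hfin]
        rw [← ENNReal.ofReal_natCast, show (3 : ℝ≥0∞) = ENNReal.ofReal 3 by norm_num,
          ← ENNReal.ofReal_mul (by positivity), ← ENNReal.ofReal_mul (by positivity),
          ← ENNReal.ofReal_mul (by positivity), ← ENNReal.ofReal_mul (by positivity),
          ← ENNReal.ofReal_add (by positivity) (by positivity)]
        congr 1
        ring
    _ ≤ _ := by
        apply ENNReal.ofReal_le_ofReal
        have h1 : 45 / 2 / α * (silh S).toReal * √(n : ℝ) ≤
            24 / α * (silh S).toReal * √(n : ℝ) := by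
          gcongr
          norm_num
        linarith

end

end

theorem theorem1 (S : Set E3) (hS : IsClosedSurface S) (hfin : silh S ≠ ∞)
    (α β : ℝ) (hα : 0 < α) (hβ : 0 < β) :
    (∃ C : ℝ, ∀ (n : ℕ) (K : Geometry.SimplicialComplex ℝ E3) (f : K.space ≃ₜ S),
      Approximates S α β n K f → expectedSilhouetteSize K ≤ ENNReal.ofReal (C * √(n : ℝ))) ∧
    ∀ (n : ℕ) (K : Geometry.SimplicialComplex ℝ E3) (f : K.space ≃ₜ S),
      Approximates S α β n K f →
        expectedSilhouetteSize K ≤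
          ENNReal.ofReal ((15 * β + 24 / α * (silh S).toReal) * √(n : ℝ)) :=
  ⟨⟨15 * β + 24 / α * (silh S).toReal, fun _ _ _ hap ↦ hap.expectedSilhouetteSize_le hα hβ hfin⟩,
    fun _ _ _ hap ↦ hap.expectedSilhouetteSize_le hα hβ hfin⟩
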